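/- **Lemma 3.3.** For each integer $l\ge 1$ let $f_l$ be the degree-$l$ Gaussian random spherical eigenfunction, i.e. the (jointly measurable) centred real Gaussian random field on the unit sphere $S^2\subset\mathbb R^3$ with covariance $$\mathbb E[f_l(x)f_l(y)]=P_l(\langle x,y\rangle),\qquad x,y\in S^2,$$ where $P_l$ is the $l$-th Legendre polynomial. Let $$h_{l;4}=\int_{S^2}H_4(f_l(x))\,dx,$$ where $H_4(t)=t^4-6t^2+3$ is the fourth (probabilists') Hermite polynomial and $dx$ is the surface measure on $S^2$, of total mass $4\pi$. Then the fourth cumulant $$\mathrm{cum}_4(h_{l;4})=\mathbb E\big[(h_{l;4}-\mathbb E h_{l;4})^4\big]-3\,\mathrm{Var}(h_{l;4})^2$$ is of exact order $l^{-4}$: there exist constants $c_1,c_2>0$ such that $$c_1\,l^{-4}\le \mathrm{cum}_4(h_{l;4})\le c_2\,l^{-4}\qquad\text{for all integers } l\ge 1.$$ -/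

import Mathlib

open MeasureTheory ProbabilityTheory Polynomial

namespace SphericalField

/-- The Euclidean unit sphere `S²` in `ℝ³`. -/
abbrev S2 : Type := Metric.sphere (0 : EuclideanSpace ℝ (Fin 3)) 1

/-- Lebesgue (surface) measure on `S²`, of total mass `4π`. -/
noncomputable def surfaceMeasure : Measure S2 :=
  (volume : Measure (EuclideanSpace ℝ (Fin 3))).toSphere

/-- The `l`-th Legendre polynomial, by Rodrigues' formula
`P_l(t) = (2^l l!)⁻¹ (d/dt)^l (t² - 1)^l`. -/
noncomputable def legendre (l : ℕ) : ℝ[X] :=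
  C (((2 : ℝ) ^ l * (l.factorial : ℝ))⁻¹) * derivative^[l] ((X ^ 2 - 1) ^ l)

/-- The degree-`l` Gaussian random spherical eigenfunction, described through its law: a centred
Gaussian field on `S²` with covariance `E[f(x) f(y)] = P_l(⟨x, y⟩)`. Of the regularity of the sample
functions only joint measurability in `(x, ω)` is asked; it holds whenever all the sample functions
are continuous, in particular when they are eigenfunctions of the spherical Laplacian. -/
structure IsGaussianEigenfunction (l : ℕ) {Ω : Type*} [MeasurableSpace Ω] (P : Measure Ω)
    (f : S2 → Ω → ℝ) : Prop where
  measurable_uncurry : Measurable (Function.uncurry f)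
  isGaussianProcess : IsGaussianProcess f P
  mean_eq_zero : ∀ x : S2, ∫ ω, f x ω ∂P = 0
  covariance_eq : ∀ x y : S2, ∫ ω, f x ω * f y ω ∂P =
    (legendre l).eval (inner ℝ (x : EuclideanSpace ℝ (Fin 3)) (y : EuclideanSpace ℝ (Fin 3)))

/-- The random variable `h_q = ∫_{S²} H_q(f(x)) dx`, with `H_q` the probabilists' Hermite polynomial
(monic, `H_q' = q H_{q-1}`, `E[H_q(Z)] = 0` for a standard normal `Z` and `q ≥ 1`). -/
noncomputable def hermiteIntegral (q : ℕ) {Ω : Type*} (f : S2 → Ω → ℝ) (ω : Ω) : ℝ :=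
  ∫ x, aeval (f x ω) (hermite q) ∂surfaceMeasure

/-- The fourth cumulant `cum₄(Y) = E[(Y - E Y)⁴] - 3 Var(Y)²` of a real random variable. -/
noncomputable def fourthCumulant {Ω : Type*} [MeasurableSpace Ω] (Y : Ω → ℝ) (P : Measure Ω) : ℝ :=
  centralMoment Y 4 P - 3 * variance Y P ^ 2

end SphericalField

/-!
The fourth cumulant is computed by the diagram formula. Put `K(x, y) = P_l(⟨x, y⟩)`. For unit
variance jointly Gaussian variables, Gaussian integration by parts expresses
`E[H₄(f(x₁)) H₄(f(x₂)) H₄(f(x₃)) H₄(f(x₄))]` through the 4-regular multigraphs on four vertices. Such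
a graph assigns to the three perfect matchings of the vertices multiplicities `a + b + c = 4`, and,
with `J(a, b, c)` the integral over four points of the corresponding product of kernels, the
contribution of `J(4, 0, 0) = (∫∫ K⁴)²` is cancelled by `3 Var²`. This leaves
(`IsGaussianEigenfunction.fourthCumulant_eq`)
`cum₄ = 6912 (8 J(3, 1, 0) + 9 J(2, 2, 0) + 36 J(2, 1, 1))`.

Lower bound. The sign of `J(2, 1, 1)` is not evident, but `J(3, 1, 0) ≥ 0` and
`J(3, 1, 0) + 5 J(2, 1, 1) ≥ 0`, since both are squared norms of integrals of tensors built from the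
vectors `f(x) ∈ L²(P)` (`IsGaussianEigenfunction.integral_symmetrized_nonneg`); the second tensor is
partially symmetrized. Hence `cum₄ ≥ 62208 J(2, 2, 0)`. By the Cauchy-Schwarz inequality
`J(2, 2, 0) ≥ κ⁴`, where `κ = ∫ K(x, y)² dy = 4π / (2l + 1)`.

Upper bound. By the inequality between arithmetic and geometric means all the integrals are bounded by
those over paths with three edges, of multiplicities `3, 2, 3`, which factorize into
`4π κ (∫ |K(x, y)|³ dy)²`. The last factor is of order `l⁻³` by Bernstein's inequality
`√(1 - t²) P_l(t)² ≤ 2 / (2l + 1)` (`sqrt_mul_legendre_sq_le_of_nonneg`), which follows from the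
monotonicity of Sonin's function.

Integrals of functions of `⟨x, y⟩` over the sphere reduce to integrals over `[-1, 1]` by Archimedes'
theorem (`lintegral_zonal`), and `∫ P_l² = 2 / (2l + 1)` follows by integrating `(t P_l²)'`, because
`t P_l' - l P_l` has degree less than `l` and is therefore orthogonal to `P_l`.
-/

open scoped ENNReal

namespace SphericalField

/-! ### Legendre polynomials -/

/-- With `W = (X² - 1) ^ l`, this is the `(k + 1)`-st derivative of `(X² - 1) W' = 2 l X W`; for
`k = l` it becomes Legendre's equation. -/
lemma legendre_iterate_relation (l k : ℕ) :
    ((X : ℝ[X]) ^ 2 - 1) * derivative^[k + 2] ((X ^ 2 - 1) ^ l)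
      + 2 * ((k : ℝ[X]) + 1 - (l : ℝ[X])) * X * derivative^[k + 1] ((X ^ 2 - 1) ^ l)
      + ((k : ℝ[X]) + 1) * ((k : ℝ[X]) - 2 * (l : ℝ[X])) * derivative^[k] ((X ^ 2 - 1) ^ l) = 0 := by
  set W : ℝ[X] := (X ^ 2 - 1) ^ l with hW
  induction k with
  | zero =>
    have h1 : ((X : ℝ[X]) ^ 2 - 1) * derivative W = 2 * (l : ℝ[X]) * X * W := by
      rcases l with _ | m
      · simp [hW]
      · rw [hW, derivative_pow]
        simp only [derivative_sub, derivative_pow, derivative_X, derivative_one]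
        simp [C_ofNat]
        ring
    have h2 := congrArg derivative h1
    simp only [derivative_mul, derivative_sub, derivative_pow, derivative_X, derivative_one,
      derivative_natCast, derivative_ofNat] at h2
    simp only [zero_add, Function.iterate_zero, id, Nat.cast_zero,
      Function.iterate_succ_apply']
    simp [C_ofNat] at h2
    linear_combination h2
  | succ k ih =>
    have h2 := congrArg derivative ih
    simp only [derivative_mul, derivative_sub, derivative_add, derivative_pow, derivative_X,
      derivative_one, derivative_natCast, derivative_ofNat,
      ← Function.iterate_succ_apply' (f := (derivative : ℝ[X] →ₗ[ℝ] ℝ[X]))] at h2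
    simp [C_ofNat] at h2
    push_cast
    simp only [← Function.iterate_succ_apply, Nat.succ_eq_add_one] at h2 ⊢
    linear_combination h2

/-- Legendre's differential equation. -/
lemma legendre_ode (l : ℕ) (t : ℝ) :
    (1 - t ^ 2) * (derivative (derivative (legendre l))).eval t
      = 2 * t * (derivative (legendre l)).eval t - l * (l + 1) * (legendre l).eval t := by
  have h := congrArg (eval t) (legendre_iterate_relation l l)
  simp only [Function.iterate_succ_apply'] at h
  simp [legendre] at h ⊢
  linear_combination (-(((l.factorial : ℝ))⁻¹ * ((2 : ℝ) ^ l)⁻¹)) * h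

/-- The derivatives of `(X² - 1) ^ l` at `1` are read off from its Taylor expansion
`(X (X + 2)) ^ l` there. -/
lemma iterate_derivative_rodrigues_eval_one (l k : ℕ) :
    (derivative^[k] (((X : ℝ[X]) ^ 2 - 1) ^ l)).eval 1
      = k.factorial * (X ^ l * (X + 2) ^ l : ℝ[X]).coeff k := by
  have h : taylor 1 (((X : ℝ[X]) ^ 2 - 1) ^ l) = X ^ l * (X + 2) ^ l := by
    simp only [taylor_pow, map_sub, taylor_X, taylor_one, ← mul_pow]
    congr 1
    simp
    ring
  rw [← h, taylor_coeff, ← factorial_smul_hasseDeriv]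
  simp

lemma iterate_derivative_rodrigues_eval_neg_one (l k : ℕ) :
    (derivative^[k] (((X : ℝ[X]) ^ 2 - 1) ^ l)).eval (-1)
      = k.factorial * (X ^ l * (X - 2) ^ l : ℝ[X]).coeff k := by
  have h : taylor (-1) (((X : ℝ[X]) ^ 2 - 1) ^ l) = X ^ l * (X - 2) ^ l := by
    simp only [taylor_pow, map_sub, taylor_X, taylor_one, ← mul_pow]
    congr 1
    simp
    ring
  rw [← h, taylor_coeff, ← factorial_smul_hasseDeriv]
  simp

lemma legendre_eval_one (l : ℕ) : (legendre l).eval 1 = 1 := by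
  have h := iterate_derivative_rodrigues_eval_one l l
  have h2 : (X ^ l * (X + 2) ^ l : ℝ[X]).coeff l = 2 ^ l := by
    rw [coeff_X_pow_mul', if_pos le_rfl, Nat.sub_self, coeff_zero_eq_eval_zero]
    simp
  have : (l.factorial : ℝ) ≠ 0 := by positivity
  rw [legendre, eval_mul, h, h2, eval_C]
  field_simp

lemma legendre_eval_neg_one_sq (l : ℕ) : (legendre l).eval (-1) ^ 2 = 1 := by
  have h := iterate_derivative_rodrigues_eval_neg_one l l
  have h2 : (X ^ l * (X - 2) ^ l : ℝ[X]).coeff l = (-2) ^ l := by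
    rw [coeff_X_pow_mul', if_pos le_rfl, Nat.sub_self, coeff_zero_eq_eval_zero]
    simp
  have : (l.factorial : ℝ) ≠ 0 := by positivity
  rw [legendre, eval_mul, h, h2, eval_C, neg_pow (2 : ℝ)]
  field_simp
  rw [← pow_mul, mul_comm, pow_mul]
  simp

lemma integral_derivative_eval (q : ℝ[X]) (a b : ℝ) :
    ∫ t in a..b, (derivative q).eval t = q.eval b - q.eval a :=
  intervalIntegral.integral_eq_sub_of_hasDerivAt (fun t _ ↦ q.hasDerivAt t)
    ((derivative q).continuous.intervalIntegrable _ _)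

/-- Repeated integration by parts; the boundary terms vanish because `(X² - 1) ^ l` has zeros of
order `l` at `±1`. -/
lemma integral_iterate_derivative_rodrigues_mul (l : ℕ) (j : ℕ) :
    ∀ q : ℝ[X], j ≤ l → derivative^[j] q = 0 →
      ∫ t in (-1 : ℝ)..1, (derivative^[j] (((X : ℝ[X]) ^ 2 - 1) ^ l)).eval t * q.eval t = 0 := by
  induction j with
  | zero => intro q _ hq; simp_all
  | succ j ih =>
    intro q hj hq
    have h1 := ih (derivative q) (by omega) (by rwa [← Function.iterate_succ_apply])
    have h2 := integral_derivative_eval (derivative^[j] (((X : ℝ[X]) ^ 2 - 1) ^ l) * q) (-1) 1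
    have e1 : (derivative^[j] (((X : ℝ[X]) ^ 2 - 1) ^ l)).eval 1 = 0 := by
      rw [iterate_derivative_rodrigues_eval_one, coeff_X_pow_mul', if_neg (by omega), mul_zero]
    have e2 : (derivative^[j] (((X : ℝ[X]) ^ 2 - 1) ^ l)).eval (-1) = 0 := by
      rw [iterate_derivative_rodrigues_eval_neg_one, coeff_X_pow_mul', if_neg (by omega), mul_zero]
    simp only [derivative_mul, eval_add, eval_mul, e1, e2, zero_mul, sub_zero] at h2
    rw [intervalIntegral.integral_add (by apply Continuous.intervalIntegrable; fun_prop)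
      (by apply Continuous.intervalIntegrable; fun_prop), h1, add_zero] at h2
    rwa [Function.iterate_succ_apply']

lemma natDegree_legendre_le (l : ℕ) : (legendre l).natDegree ≤ l := by
  refine (natDegree_C_mul_le _ _).trans ((natDegree_iterate_derivative _ _).trans ?_)
  have : ((X : ℝ[X]) ^ 2 - 1).natDegree ≤ 2 := by compute_degree
  have := (natDegree_pow_le (p := (X : ℝ[X]) ^ 2 - 1) (n := l)).trans (Nat.mul_le_mul_left l this)
  omega

/-- A Legendre polynomial is orthogonal to all polynomials of smaller degree. -/
lemma integral_legendre_mul_eq_zero (l : ℕ) (q : ℝ[X]) (hq : q.degree < (l : WithBot ℕ)) :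
    ∫ t in (-1 : ℝ)..1, (legendre l).eval t * q.eval t = 0 := by
  have h0 : derivative^[l] q = 0 := by
    by_cases hq0 : q = 0
    · simp [hq0]
    · exact iterate_derivative_eq_zero ((natDegree_lt_iff_degree_lt hq0).2 hq)
  have h := integral_iterate_derivative_rodrigues_mul l l q le_rfl h0
  simp only [legendre, eval_mul, eval_C, mul_assoc]
  rw [intervalIntegral.integral_const_mul, h, mul_zero]

/-- Integrate `(t p²)' = (2 l + 1) p² + 2 p (t p' - l p)`: the last factor has degree less than `l`,
and `p(±1)² = 1`. -/
lemma integral_legendre_sq (l : ℕ) :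
    ∫ t in (-1 : ℝ)..1, (legendre l).eval t ^ 2 = 2 / (2 * l + 1) := by
  set p := legendre l with hp
  have hq : (X * derivative p - C (l : ℝ) * p).degree < (l : WithBot ℕ) := by
    rw [degree_lt_iff_coeff_zero]
    intro m hm
    have hc : (X * derivative p).coeff m = m * p.coeff m := by
      rcases m with _ | m
      · simp
      · rw [coeff_X_mul, coeff_derivative]; push_cast; ring
    rw [coeff_sub, hc, coeff_C_mul]
    rcases hm.eq_or_lt with rfl | hm
    · ring
    · rw [coeff_eq_zero_of_natDegree_lt ((natDegree_legendre_le l).trans_lt hm)]; ring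
  have h1 := integral_legendre_mul_eq_zero l _ hq
  have h2 := integral_derivative_eval (X * p ^ 2) (-1) 1
  simp only [eval_mul, eval_X, eval_pow, hp, legendre_eval_one, legendre_eval_neg_one_sq] at h2
  rw [← hp] at h1 h2
  have e : ∀ t : ℝ, (derivative (X * p ^ 2)).eval t = (2 * l + 1) * p.eval t ^ 2
      + 2 * (p.eval t * (X * derivative p - C (l : ℝ) * p).eval t) := by
    intro t
    simp [derivative_mul, derivative_pow]
    ring
  simp only [e] at h2
  rw [intervalIntegral.integral_add (by apply Continuous.intervalIntegrable; fun_prop)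
      (by apply Continuous.intervalIntegrable; fun_prop), intervalIntegral.integral_const_mul,
      intervalIntegral.integral_const_mul, h1] at h2
  field_simp
  linarith

/-- Integration by parts in Legendre's equation multiplied by `p`. -/
lemma integral_derivative_legendre_sq (l : ℕ) :
    ∫ t in (-1 : ℝ)..1, (1 - t ^ 2) * (derivative (legendre l)).eval t ^ 2
      = (l : ℝ) * (l + 1) * (2 / (2 * l + 1)) := by
  rw [← integral_legendre_sq]
  set p := legendre l with hp
  have h2 := integral_derivative_eval ((1 - X ^ 2) * derivative p * p) (-1) 1
  have e : ∀ t : ℝ, (derivative ((1 - X ^ 2) * derivative p * p)).eval t =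
      (1 - t ^ 2) * (derivative p).eval t ^ 2 - l * (l + 1) * p.eval t ^ 2 := by
    intro t
    have := legendre_ode l t
    rw [← hp] at this
    simp [derivative_mul, derivative_pow]
    linear_combination eval t p * this
  simp only [e] at h2
  rw [intervalIntegral.integral_sub (by apply Continuous.intervalIntegrable; fun_prop)
      (by apply Continuous.intervalIntegrable; fun_prop), intervalIntegral.integral_const_mul] at h2
  simp at h2
  linarith

/-- The energy `N p² + (1 - t²) p'²`, `N = l (l + 1)`, is minimal at `t = 0`, hence at most its
mean over `[-1, 1]`. -/
lemma legendre_energy_zero_le (l : ℕ) :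
    l * (l + 1) * (legendre l).eval 0 ^ 2 + (derivative (legendre l)).eval 0 ^ 2
      ≤ l * (l + 1) * (2 / (2 * l + 1)) := by
  set p := legendre l with hp
  set v : ℝ[X] := C ((l : ℝ) * (l + 1)) * p ^ 2 + (1 - X ^ 2) * derivative p ^ 2 with hv
  have dv : ∀ t : ℝ, (derivative v).eval t = 2 * t * (derivative p).eval t ^ 2 := by
    intro t
    have := legendre_ode l t
    rw [← hp] at this
    simp [hv, derivative_mul, derivative_pow]
    linear_combination 2 * (derivative p).eval t * this
  have ev : ∀ t : ℝ, v.eval t = l * (l + 1) * p.eval t ^ 2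
      + (1 - t ^ 2) * (derivative p).eval t ^ 2 := by intro t; simp [hv]
  have hmin : ∀ t : ℝ, v.eval 0 ≤ v.eval t := by
    intro t
    have h := integral_derivative_eval v 0 t
    have : 0 ≤ ∫ s in (0 : ℝ)..t, (derivative v).eval s := by
      simp only [dv]
      rcases le_total 0 t with ht | ht
      · exact intervalIntegral.integral_nonneg ht fun s hs ↦ by have := hs.1; positivity
      · rw [intervalIntegral.integral_symm, ← intervalIntegral.integral_neg]
        refine intervalIntegral.integral_nonneg ht fun s hs ↦ ?_
        have := mul_nonneg (neg_nonneg.2 hs.2) (sq_nonneg ((derivative p).eval s))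
        linarith
    linarith
  have hint : ∫ t in (-1 : ℝ)..1, v.eval t = 2 * (l * (l + 1) * (2 / (2 * l + 1))) := by
    simp only [ev]
    rw [intervalIntegral.integral_add (by apply Continuous.intervalIntegrable; fun_prop)
      (by apply Continuous.intervalIntegrable; fun_prop), intervalIntegral.integral_const_mul,
      hp, integral_derivative_legendre_sq, integral_legendre_sq]
    ring
  have hle : ∫ _ in (-1 : ℝ)..1, v.eval 0 ≤ ∫ t in (-1 : ℝ)..1, v.eval t :=
    intervalIntegral.integral_mono_on (by norm_num)
      (by apply Continuous.intervalIntegrable; fun_prop)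
      (by apply Continuous.intervalIntegrable; fun_prop) fun t _ ↦ hmin t
  rw [hint, intervalIntegral.integral_const, ev] at hle
  simp at hle
  linarith

/-- Bernstein's inequality on `[0, 1)`, by Sonin's method: for `w = 1 - t²` and
`a = (l + 1/2)²`, the function `√w (p² + (t p / 2 - w p')² / (a w + 1/4))` decreases. -/
lemma sqrt_mul_legendre_sq_le_of_nonneg (l : ℕ) (hl : 1 ≤ l) {t : ℝ} (h0 : 0 ≤ t) (h1 : t < 1) :
    √(1 - t ^ 2) * (legendre l).eval t ^ 2 ≤ 2 / (2 * l + 1) := by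
  set p := legendre l with hp
  set a : ℝ := (l + 1 / 2) ^ 2 with ha
  have hapos : 0 < a := by positivity
  set G : ℝ → ℝ := fun s ↦ √(1 - s ^ 2) * (p.eval s ^ 2
    + (s * p.eval s / 2 - (1 - s ^ 2) * (derivative p).eval s) ^ 2 / (a * (1 - s ^ 2) + 1 / 4))
    with hG
  have hanti : AntitoneOn G (Set.Ico 0 1) := by
    have hd : ∀ s ∈ Set.Ico (0 : ℝ) 1, HasDerivAt G
        (-(s * (s * p.eval s / 2 - (1 - s ^ 2) * (derivative p).eval s) ^ 2)
          / (2 * √(1 - s ^ 2) * (a * (1 - s ^ 2) + 1 / 4) ^ 2)) s := by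
      intro s hs
      have hw : 0 < 1 - s ^ 2 := by nlinarith [hs.1, hs.2]
      have hode := legendre_ode l s
      rw [← hp] at hode
      have dw : HasDerivAt (fun s : ℝ ↦ 1 - s ^ 2) (-(2 * s)) s := by
        simpa using (hasDerivAt_pow 2 s).const_sub 1
      have hD : 0 < a * (1 - s ^ 2) + 1 / 4 := by positivity
      have hr : 0 < √(1 - s ^ 2) := Real.sqrt_pos.2 hw
      have hrr : √(1 - s ^ 2) ^ 2 = 1 - s ^ 2 := Real.sq_sqrt hw.le
      have h := (dw.sqrt hw.ne').mul (((p.hasDerivAt s).pow 2).add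
        (((((hasDerivAt_id s).mul (p.hasDerivAt s)).div_const 2).sub
          (dw.mul ((derivative p).hasDerivAt s))).pow 2 |>.div ((dw.const_mul a).add_const (1 / 4))
          hD.ne'))
      refine h.congr_deriv ?_
      simp only [Pi.mul_apply, Pi.sub_apply, Pi.add_apply, Pi.pow_apply, Pi.div_apply, id]
      set r := √(1 - s ^ 2) with hr'
      rw [← hrr] at hode hD ⊢
      set P0 := p.eval s
      set P1 := (derivative p).eval s
      set P2 := (derivative (derivative p)).eval s
      clear_value r P0 P1 P2
      clear hr' h dw
      field_simp
      rw [ha]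
      push_cast
      -- the differential equation eliminates `p''`, and `r² + s² = 1` does the rest
      linear_combination (-32 * r ^ 2 * (r ^ 2 * (l + 1 / 2) ^ 2 * 4 + 1)
        * (s * P0 - 2 * r ^ 2 * P1)) * hode
        + (8 * P0 * (s * P0 - 2 * r ^ 2 * P1) * (r ^ 2 * (l + 1 / 2) ^ 2 * 4 + 1)) * hrr
    refine antitoneOn_of_hasDerivWithinAt_nonpos (convex_Ico 0 1)
      (fun s hs ↦ (hd s hs).continuousAt.continuousWithinAt)
      (fun s hs ↦ (hd s (interior_subset hs)).hasDerivWithinAt) fun s hs ↦ ?_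
    have hs' := interior_subset hs
    have := hs'.1
    exact div_nonpos_of_nonpos_of_nonneg (by simp only [neg_nonpos]; positivity) (by positivity)
  have hG0 : G 0 ≤ 2 / (2 * l + 1) := by
    have hE := legendre_energy_zero_le l
    have : G 0 = p.eval 0 ^ 2 + (derivative p).eval 0 ^ 2 / (a + 1 / 4) := by simp [hG]
    rw [this]
    have hN : (0 : ℝ) < l * (l + 1) := by positivity
    have h2 : (derivative p).eval 0 ^ 2 / (a + 1 / 4) ≤ (derivative p).eval 0 ^ 2 / (l * (l + 1)) :=
      div_le_div_of_nonneg_left (sq_nonneg _) hN (by rw [ha]; nlinarith)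
    have h3 : p.eval 0 ^ 2 + (derivative p).eval 0 ^ 2 / (l * (l + 1)) ≤ 2 / (2 * l + 1) := by
      rw [← mul_le_mul_iff_right₀ hN]
      refine le_trans (le_of_eq ?_) hE
      field_simp
      rfl
    linarith
  have hw : 0 < 1 - t ^ 2 := by nlinarith
  have h3 : √(1 - t ^ 2) * p.eval t ^ 2 ≤ G t := by
    simp only [hG]
    gcongr
    have : 0 ≤ (t * p.eval t / 2 - (1 - t ^ 2) * (derivative p).eval t) ^ 2
      / (a * (1 - t ^ 2) + 1 / 4) := by positivity
    linarith
  exact h3.trans ((hanti ⟨le_rfl, one_pos⟩ ⟨h0, h1⟩ h0).trans hG0)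

/-! ### Zonal integrals over the sphere -/

/-- Euclidean three-space. -/
abbrev R3 : Type := EuclideanSpace ℝ (Fin 3)

/-- Polar coordinates for functions that are homogeneous of degree zero. -/
lemma setLIntegral_ball_eq_lintegral_surfaceMeasure
    (h : R3 → ℝ≥0∞) (hh : Measurable h)
    (hom : ∀ (r : ℝ) (x : R3), 0 < r → h (r • x) = h x) :
    ∫⁻ x : S2, h x ∂surfaceMeasure = 3 * ∫⁻ y in Metric.ball 0 1, h y := by
  have hm := (volume : Measure R3).measurePreserving_homeomorphUnitSphereProd
  have h1 : ∫⁻ y in Metric.ball (0 : R3) 1, h y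
      = ∫⁻ z : S2 × Set.Ioi (0 : ℝ), h z.1 *
          (Set.Iio (⟨1, Set.mem_Ioi.2 one_pos⟩ : Set.Ioi (0 : ℝ))).indicator 1 z.2
        ∂((volume : Measure R3).toSphere.prod (Measure.volumeIoiPow (Module.finrank ℝ R3 - 1))) := by
    rw [← hm.lintegral_comp_emb (Homeomorph.measurableEmbedding _)]
    rw [← lintegral_indicator Metric.isOpen_ball.measurableSet]
    have : ∫⁻ y : R3, (Metric.ball (0 : R3) 1).indicator h y
        = ∫⁻ y in ({0}ᶜ : Set R3), (Metric.ball (0 : R3) 1).indicator h y := by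
      rw [restrict_compl_singleton]
    rw [this, ← lintegral_subtype_comap (measurableSet_singleton _).compl]
    refine lintegral_congr fun y ↦ ?_
    have hy : (0 : ℝ) < ‖(y : R3)‖ := norm_pos_iff.2 y.2
    have e1 : h ((homeomorphUnitSphereProd R3 y).1 : R3) = h y := by
      simp only [homeomorphUnitSphereProd_apply_fst_coe]
      exact hom _ _ (inv_pos.2 hy)
    rw [e1]
    by_cases hb : ‖(y : R3)‖ < 1
    · rw [Set.indicator_of_mem (by simpa using hb), Set.indicator_of_mem]
      · simp
      · simpa [← Subtype.coe_lt_coe] using hb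
    · rw [Set.indicator_of_notMem (by simpa using hb), Set.indicator_of_notMem]
      · simp
      · simpa [← Subtype.coe_lt_coe] using hb
  rw [h1, lintegral_prod_mul (f := fun x : S2 ↦ h x)
    (g := (Set.Iio (⟨1, Set.mem_Ioi.2 one_pos⟩ : Set.Ioi (0 : ℝ))).indicator 1) (by fun_prop)
    (by exact (measurable_one.indicator measurableSet_Iio).aemeasurable),
    lintegral_indicator measurableSet_Iio]
  simp only [Pi.one_apply, lintegral_const, Measure.restrict_apply, MeasurableSet.univ,
    Set.univ_inter, one_mul, Measure.volumeIoiPow_apply_Iio]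
  rw [surfaceMeasure, mul_comm, mul_assoc]
  have : Module.finrank ℝ R3 = 3 := by simp
  rw [this]
  have h3 : ENNReal.ofReal ((1 : ℝ) ^ (3 - 1 + 1) / (((3 - 1 : ℕ) : ℝ) + 1)) * 3 = 1 := by
    rw [← ENNReal.ofReal_ofNat 3, ← ENNReal.ofReal_mul (by positivity)]
    norm_num
  rw [h3, mul_one]

/-- Integration over the ball of a function of the polar angle, in cylindrical coordinates. -/
lemma lintegral_zonal_prod (g : ℝ → ℝ≥0∞) (hg : Measurable g) :
    3 * ∫⁻ z : ℝ × ℝ × ℝ, ({z | z.1 ^ 2 + (z.2.1 ^ 2 + z.2.2 ^ 2) < 1} : Set (ℝ × ℝ × ℝ)).indicator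
      (fun z ↦ g (z.1 / √(z.1 ^ 2 + (z.2.1 ^ 2 + z.2.2 ^ 2)))) z
    = ENNReal.ofReal (2 * Real.pi) * ∫⁻ θ in Set.Ioo 0 Real.pi,
        ENNReal.ofReal (Real.sin θ) * g (Real.cos θ) := by
  -- the integrand as a function of the height and of the distance to the axis
  set F : ℝ × ℝ → ℝ≥0∞ := ({z : ℝ × ℝ | z.1 ^ 2 + z.2 ^ 2 < 1} : Set (ℝ × ℝ)).indicator
      (fun z ↦ g (z.1 / √(z.1 ^ 2 + z.2 ^ 2))) with hF
  have hFm : Measurable F := by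
    refine Measurable.indicator (by fun_prop) (measurableSet_lt (by fun_prop) (by fun_prop))
  have hpol : ∀ ρ θ : ℝ, 0 < ρ → F (ρ * Real.cos θ, ρ * Real.sin θ) =
      (Set.Iio 1).indicator 1 ρ * g (Real.cos θ) := by
    intro ρ θ hρ
    have e : (ρ * Real.cos θ) ^ 2 + (ρ * Real.sin θ) ^ 2 = ρ ^ 2 := by
      linear_combination ρ ^ 2 * Real.cos_sq_add_sin_sq θ
    simp only [hF, Set.indicator_apply, Set.mem_ofPred_eq, e, Real.sqrt_sq hρ.le, Set.mem_Iio,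
      Pi.one_apply, sq_lt_one_iff₀ hρ.le, mul_div_cancel_left₀ _ hρ.ne']
    split_ifs <;> simp
  -- the half plane `r > 0` in polar coordinates
  have hhalf : ∫⁻ z : ℝ × ℝ, (Set.Ioi (0 : ℝ)).indicator 1 z.2 * (ENNReal.ofReal z.2 * F z)
      = ENNReal.ofReal (1 / 3) * ∫⁻ θ in Set.Ioo 0 Real.pi,
        ENNReal.ofReal (Real.sin θ) * g (Real.cos θ) := by
    rw [← lintegral_comp_polarCoord_symm, polarCoord_target]
    have : ∀ p ∈ Set.Ioi (0 : ℝ) ×ˢ Set.Ioo (-Real.pi) Real.pi, ENNReal.ofReal p.1 •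
        ((Set.Ioi (0 : ℝ)).indicator 1 (polarCoord.symm p).2 *
          (ENNReal.ofReal (polarCoord.symm p).2 * F (polarCoord.symm p)))
        = ((Set.Iio 1).indicator (fun ρ ↦ ENNReal.ofReal (ρ ^ 2)) p.1) *
          (Set.Ioo 0 Real.pi).indicator
            (fun θ ↦ ENNReal.ofReal (Real.sin θ) * g (Real.cos θ)) p.2 := by
      rintro ⟨ρ, θ⟩ ⟨hρ, hθ⟩
      simp only [Set.mem_Ioi] at hρ
      simp only [polarCoord_symm_apply]
      rw [hpol ρ θ hρ]
      by_cases h0 : 0 < θ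
      · have hs : 0 < Real.sin θ := Real.sin_pos_of_pos_of_lt_pi h0 hθ.2
        rw [Set.indicator_of_mem (s := Set.Ioi (0 : ℝ)) (by simp; positivity),
          Set.indicator_of_mem (s := Set.Ioo 0 Real.pi) ⟨h0, hθ.2⟩]
        simp only [Set.indicator_apply, Set.mem_Iio, Pi.one_apply]
        split_ifs
        · rw [ENNReal.ofReal_mul hρ.le, ENNReal.ofReal_pow hρ.le]; simp; ring
        · simp
      · have hs : Real.sin θ ≤ 0 := Real.sin_nonpos_of_nonpos_of_neg_pi_le (not_lt.1 h0) hθ.1.le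
        rw [Set.indicator_of_notMem (s := Set.Ioi (0 : ℝ)), Set.indicator_of_notMem
          (s := Set.Ioo 0 Real.pi)]
        · simp
        · simp [h0]
        · simpa using mul_nonpos_of_nonneg_of_nonpos hρ.le hs
    rw [setLIntegral_congr_fun (measurableSet_Ioi.prod measurableSet_Ioo) this,
      Measure.volume_eq_prod, ← Measure.prod_restrict, lintegral_prod_mul
      (by exact (Measurable.indicator (by fun_prop) measurableSet_Iio).aemeasurable)
      (by exact (Measurable.indicator (by fun_prop) measurableSet_Ioo).aemeasurable)]
    congr 1
    · rw [setLIntegral_indicator measurableSet_Iio, Set.inter_comm, Set.Ioi_inter_Iio,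
        Measure.restrict_congr_set Ioo_ae_eq_Ioc, ← ofReal_integral_eq_lintegral_ofReal
        (intervalIntegral.intervalIntegrable_pow _).1, ← intervalIntegral.integral_of_le zero_le_one]
      · norm_num
      · filter_upwards with y using sq_nonneg y
    · rw [setLIntegral_indicator measurableSet_Ioo, Set.inter_eq_left.2]
      exact Set.Ioo_subset_Ioo_left (by linarith [Real.pi_pos])
  -- polar coordinates in the plane orthogonal to the axis
  have hplane : ∀ t : ℝ, ∫⁻ w : ℝ × ℝ, ({z | z.1 ^ 2 + (z.2.1 ^ 2 + z.2.2 ^ 2) < 1} :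
      Set (ℝ × ℝ × ℝ)).indicator (fun z ↦ g (z.1 / √(z.1 ^ 2 + (z.2.1 ^ 2 + z.2.2 ^ 2)))) (t, w)
      = ENNReal.ofReal (2 * Real.pi) *
        ∫⁻ r, (Set.Ioi (0 : ℝ)).indicator 1 r * (ENNReal.ofReal r * F (t, r)) := by
    intro t
    rw [← lintegral_comp_polarCoord_symm, polarCoord_target]
    have : ∀ p ∈ Set.Ioi (0 : ℝ) ×ˢ Set.Ioo (-Real.pi) Real.pi, ENNReal.ofReal p.1 •
        (({z | z.1 ^ 2 + (z.2.1 ^ 2 + z.2.2 ^ 2) < 1} : Set (ℝ × ℝ × ℝ)).indicator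
          (fun z ↦ g (z.1 / √(z.1 ^ 2 + (z.2.1 ^ 2 + z.2.2 ^ 2)))) (t, polarCoord.symm p))
        = (ENNReal.ofReal p.1 * F (t, p.1)) * 1 := by
      rintro ⟨ρ, θ⟩ ⟨hρ, hθ⟩
      have e : (ρ * Real.cos θ) ^ 2 + (ρ * Real.sin θ) ^ 2 = ρ ^ 2 := by
        linear_combination ρ ^ 2 * Real.cos_sq_add_sin_sq θ
      simp only [polarCoord_symm_apply, hF, Set.indicator_apply, Set.mem_ofPred_eq, e, smul_eq_mul,
        mul_one]
    rw [setLIntegral_congr_fun (measurableSet_Ioi.prod measurableSet_Ioo) this,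
      Measure.volume_eq_prod, ← Measure.prod_restrict, lintegral_prod_mul
      (f := fun r ↦ ENNReal.ofReal r * F (t, r)) (g := fun _ ↦ 1) (by fun_prop) (by fun_prop)]
    simp only [lintegral_const, one_mul, Measure.restrict_apply, MeasurableSet.univ, Set.univ_inter,
      Real.volume_Ioo]
    rw [mul_comm, ← lintegral_indicator measurableSet_Ioi]
    congr 1
    · congr 1; ring
    · refine lintegral_congr fun r ↦ ?_
      simp only [Set.indicator_apply]; split_ifs <;> simp
  rw [Measure.volume_eq_prod, lintegral_prod _ (by
    refine Measurable.aemeasurable (Measurable.indicator (by fun_prop) ?_)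
    exact measurableSet_lt (by fun_prop) (by fun_prop))]
  simp_rw [hplane]
  have hm : Measurable (fun z : ℝ × ℝ ↦ (Set.Ioi (0 : ℝ)).indicator 1 z.2 * (ENNReal.ofReal z.2 * F z)) :=
    Measurable.mul ((measurable_one.indicator measurableSet_Ioi).comp measurable_snd) (by fun_prop)
  rw [lintegral_const_mul _ hm.lintegral_prod_right', ← lintegral_prod _ hm.aemeasurable,
    ← Measure.volume_eq_prod, hhalf, mul_left_comm, ← mul_assoc 3]
  have h3 : (3 : ℝ≥0∞) * ENNReal.ofReal (1 / 3) = 1 := by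
    rw [← ENNReal.ofReal_ofNat 3, ← ENNReal.ofReal_mul (by positivity)]
    norm_num
  rw [h3, one_mul]

/-- The equivalence between Euclidean space `ℝ³` and `ℝ × ℝ × ℝ` preserves volume. -/
lemma measurePreserving_euclidean_prod :
    MeasurePreserving (fun y : R3 ↦ ((y 0, y 1, y 2) : ℝ × ℝ × ℝ))
      volume volume := by
  have h1 : MeasurePreserving (fun y : R3 ↦ y.ofLp) volume volume :=
    PiLp.volume_preserving_ofLp (Fin 3)
  have h2 := volume_preserving_piFinSuccAbove (fun _ : Fin 3 ↦ ℝ) 0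
  have h3 := (MeasurePreserving.id (volume : Measure ℝ)).prod (volume_preserving_finTwoArrow ℝ)
  exact (h3.comp h2).comp h1

/-- **Archimedes' hat-box theorem**: the projection of the surface measure to an axis is uniform. -/
lemma lintegral_zonal (g : ℝ → ℝ≥0∞) (hg : Measurable g) (x : S2) :
    ∫⁻ y : S2, g (inner ℝ (x : R3) (y : R3))
        ∂surfaceMeasure
      = ENNReal.ofReal (2 * Real.pi) * ∫⁻ θ in Set.Ioo 0 Real.pi,
        ENNReal.ofReal (Real.sin θ) * g (Real.cos θ) := by
  have hx : ‖(x : R3)‖ = 1 := by simp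
  obtain ⟨b, hb⟩ : ∃ b : OrthonormalBasis (Fin 3) ℝ R3, b 0 = x := by
    have := Orthonormal.exists_orthonormalBasis_extension_of_card_eq (ι := Fin 3) (𝕜 := ℝ) (E := R3)
      (by simp) (v := fun _ ↦ (x : R3)) (s := {0}) (by
        refine ⟨fun _ ↦ by simp, fun i j hij ↦ (hij (Subsingleton.elim _ _)).elim⟩)
    obtain ⟨b, hb⟩ := this
    exact ⟨b, hb 0 rfl⟩
  have h0 := setLIntegral_ball_eq_lintegral_surfaceMeasure
    (fun y ↦ g (inner ℝ (x : R3) y / ‖y‖)) (by fun_prop) (by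
      intro r y hr
      rw [inner_smul_right, norm_smul, Real.norm_of_nonneg hr.le, mul_div_mul_left _ _ hr.ne'])
  have hs : ∀ y : S2, ‖(y : R3)‖ = 1 := fun y ↦ by simp
  simp only [hs, div_one] at h0
  rw [h0, ← lintegral_zonal_prod g hg, ← measurePreserving_euclidean_prod.lintegral_comp,
    ← b.measurePreserving_repr.lintegral_comp, ← lintegral_indicator Metric.isOpen_ball.measurableSet]
  · congr 1
    refine lintegral_congr fun y ↦ ?_
    have e1 : (b.repr y) 0 = inner ℝ (x : R3) y := by rw [b.repr_apply_apply, hb]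
    have e2 : (b.repr y) 0 ^ 2 + ((b.repr y) 1 ^ 2 + (b.repr y) 2 ^ 2) = ‖y‖ ^ 2 := by
      rw [← b.repr.norm_map, EuclideanSpace.norm_sq_eq]
      simp [Fin.sum_univ_three]; ring
    by_cases hb : ‖y‖ < 1
    · rw [Set.indicator_of_mem (by simpa using hb), Set.indicator_of_mem, e2, e1,
        Real.sqrt_sq (norm_nonneg _)]
      simpa only [Set.mem_ofPred_eq, e2, sq_lt_one_iff₀ (norm_nonneg _)] using hb
    · rw [Set.indicator_of_notMem (by simpa using hb), Set.indicator_of_notMem]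
      simpa only [Set.mem_ofPred_eq, e2, sq_lt_one_iff₀ (norm_nonneg _)] using hb
  · refine Measurable.comp (Measurable.indicator (by fun_prop) ?_) (by fun_prop)
    exact measurableSet_lt (by fun_prop) (by fun_prop)
  · refine Measurable.indicator (by fun_prop) ?_
    exact measurableSet_lt (by fun_prop) (by fun_prop)

/-- Archimedes' hat-box theorem for nonnegative continuous functions. -/
lemma integral_zonal (g : ℝ → ℝ) (hg : Continuous g) (h0 : ∀ t, 0 ≤ g t) (x : S2) :
    ∫ y : S2, g (inner ℝ (x : R3) (y : R3))
        ∂surfaceMeasure = 2 * Real.pi * ∫ t in (-1 : ℝ)..1, g t := by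
  have e1 : ∫ t in (-1 : ℝ)..1, g t = ∫ θ in (0 : ℝ)..Real.pi, Real.sin θ * g (Real.cos θ) := by
    have := intervalIntegral.integral_comp_mul_deriv (a := 0) (b := Real.pi) (f := Real.cos)
      (f' := fun θ ↦ -Real.sin θ) (g := g) (fun θ _ ↦ Real.hasDerivAt_cos θ) (by fun_prop) hg
    rw [Real.cos_zero, Real.cos_pi] at this
    rw [intervalIntegral.integral_symm, ← this, ← intervalIntegral.integral_neg]
    refine intervalIntegral.integral_congr fun θ _ ↦ ?_
    simp only [Function.comp]; ring
  rw [integral_eq_lintegral_of_nonneg_ae (Filter.Eventually.of_forall fun y ↦ h0 _)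
    (by fun_prop), lintegral_zonal (fun t ↦ ENNReal.ofReal (g t)) (by fun_prop),
    ENNReal.toReal_mul, ENNReal.toReal_ofReal (by positivity), e1,
    intervalIntegral.integral_of_le Real.pi_pos.le, integral_Ioc_eq_integral_Ioo]
  congr 1
  rw [integral_eq_lintegral_of_nonneg_ae _ (by fun_prop)]
  · congr 1
    refine setLIntegral_congr_fun measurableSet_Ioo fun θ hθ ↦ ?_
    rw [ENNReal.ofReal_mul (Real.sin_pos_of_pos_of_lt_pi hθ.1 hθ.2).le]
  · filter_upwards [ae_restrict_mem measurableSet_Ioo] with θ hθ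
    exact mul_nonneg (Real.sin_pos_of_pos_of_lt_pi hθ.1 hθ.2).le (h0 _)

/-! ### The third absolute moment of a Legendre polynomial -/

lemma legendre_eval_neg (l : ℕ) (t : ℝ) :
    (legendre l).eval (-t) = (-1) ^ l * (legendre l).eval t := by
  have h : ∀ (k : ℕ) (q : ℝ[X]), (derivative^[k] (q.comp (-X)))
      = (-1) ^ k * (derivative^[k] q).comp (-X) := by
    intro k
    induction k with
    | zero => simp
    | succ k ih =>
      intro q
      rw [Function.iterate_succ_apply, Function.iterate_succ_apply, derivative_comp, derivative_neg,
        derivative_X, neg_one_mul, iterate_derivative_neg, ih]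
      ring
  have h2 := congrArg (eval t) (h l ((X ^ 2 - 1) ^ l))
  simp at h2
  simp only [legendre, eval_mul, eval_C]
  rw [h2, mul_left_comm, ← mul_assoc ((-1) ^ l) ((-1) ^ l), ← mul_pow]
  simp

lemma abs_legendre_pow_three_le (l : ℕ) (hl : 1 ≤ l) {t : ℝ} (h0 : 0 ≤ t) (h1 : t < 1) :
    |(legendre l).eval t| ^ 3 ≤ √(2 / (2 * l + 1)) ^ 3 * (1 - t) ^ (-(3 / 4) : ℝ) := by
  have hB := sqrt_mul_legendre_sq_le_of_nonneg l hl h0 h1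
  set J : ℝ := 2 / (2 * l + 1)
  have ht : 0 < 1 - t := by linarith
  set u : ℝ := (1 - t) ^ (1 / 4 : ℝ) with hu
  have hu0 : 0 < u := Real.rpow_pos_of_pos ht _
  have hu2 : u ^ 2 = √(1 - t) := by
    rw [hu, ← Real.rpow_natCast, ← Real.rpow_mul ht.le, Real.sqrt_eq_rpow]; norm_num
  have hu3 : (1 - t) ^ (-(3 / 4) : ℝ) = (u ^ 3)⁻¹ := by
    rw [hu, Real.rpow_neg ht.le, ← Real.rpow_natCast, ← Real.rpow_mul ht.le]; norm_num
  have h2 : √(1 - t) ≤ √(1 - t ^ 2) := Real.sqrt_le_sqrt (by nlinarith)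
  have h3 : (|(legendre l).eval t| * u) ^ 2 ≤ J := by
    rw [mul_pow, sq_abs, hu2, mul_comm]
    exact (mul_le_mul_of_nonneg_right h2 (sq_nonneg _)).trans hB
  have h4 : |(legendre l).eval t| * u ≤ √J := Real.le_sqrt_of_sq_le h3
  rw [hu3, ← div_eq_mul_inv, le_div_iff₀ (by positivity), ← mul_pow]
  gcongr

lemma integral_abs_legendre_pow_three_le (l : ℕ) (hl : 1 ≤ l) :
    ∫ t in (-1 : ℝ)..1, |(legendre l).eval t| ^ 3 ≤ 8 * √(2 / (2 * l + 1)) ^ 3 := by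
  have hc : Continuous fun t : ℝ ↦ |(legendre l).eval t| ^ 3 := by fun_prop
  have hI : IntervalIntegrable (fun t : ℝ ↦ (1 - t) ^ (-(3 / 4) : ℝ)) volume 0 1 := by
    have := (intervalIntegral.intervalIntegrable_rpow' (a := 0) (b := 1)
      (r := (-(3 / 4) : ℝ)) (by norm_num)).comp_sub_left 1
    simpa using this.symm
  have hv : ∫ t in (0 : ℝ)..1, (1 - t) ^ (-(3 / 4) : ℝ) = 4 := by
    rw [intervalIntegral.integral_comp_sub_left (fun t ↦ t ^ (-(3 / 4) : ℝ)) 1, sub_self, sub_zero,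
      integral_rpow (Or.inl (by norm_num))]
    norm_num
  have hpos : ∫ t in (0 : ℝ)..1, |(legendre l).eval t| ^ 3 ≤ 4 * √(2 / (2 * l + 1)) ^ 3 := by
    have := intervalIntegral.integral_mono_on_of_le_Ioo zero_le_one (hc.intervalIntegrable 0 1)
      (hI.const_mul (√(2 / (2 * l + 1)) ^ 3))
      (fun t ht ↦ abs_legendre_pow_three_le l hl ht.1.le ht.2)
    rw [intervalIntegral.integral_const_mul, hv] at this
    linarith
  have hneg : ∫ t in (-1 : ℝ)..0, |(legendre l).eval t| ^ 3
      = ∫ t in (0 : ℝ)..1, |(legendre l).eval t| ^ 3 := by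
    have := intervalIntegral.integral_comp_neg (a := 0) (b := 1)
      (fun t : ℝ ↦ |(legendre l).eval t| ^ 3)
    rw [neg_zero] at this
    rw [← this]
    simp [legendre_eval_neg, abs_mul]
  rw [← intervalIntegral.integral_add_adjacent_intervals (hc.intervalIntegrable (-1) 0)
    (hc.intervalIntegrable 0 1), hneg]
  linarith

/-! ### The covariance kernel -/

/-- The covariance kernel `K(x, y) = P_l(⟨x, y⟩)` of the degree-`l` spherical eigenfunction. -/
noncomputable def kernel (l : ℕ) (x y : S2) : ℝ :=
  (legendre l).eval (inner ℝ (x : R3) (y : R3))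

lemma continuous_kernel (l : ℕ) : Continuous fun z : S2 × S2 ↦ kernel l z.1 z.2 := by
  unfold kernel; fun_prop

@[fun_prop]
lemma continuous_kernel_comp {α : Type*} [TopologicalSpace α] {f g : α → S2} (l : ℕ)
    (hf : Continuous f) (hg : Continuous g) : Continuous fun a ↦ kernel l (f a) (g a) :=
  (continuous_kernel l).comp (hf.prodMk hg)

lemma kernel_comm (l : ℕ) (x y : S2) : kernel l x y = kernel l y x := by
  rw [kernel, real_inner_comm, kernel]

lemma kernel_self (l : ℕ) (x : S2) : kernel l x x = 1 := by
  rw [kernel, real_inner_self_eq_norm_sq]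
  simp [legendre_eval_one]

instance : IsFiniteMeasure surfaceMeasure := by unfold surfaceMeasure; infer_instance

lemma surfaceMeasure_real_univ : surfaceMeasure.real Set.univ = 4 * Real.pi := by
  have := integral_zonal (fun _ ↦ 1) continuous_const (fun _ ↦ zero_le_one) (Nonempty.some
    (NormedSpace.sphere_nonempty (E := R3) |>.2 zero_le_one).to_subtype)
  simp at this
  linarith

lemma integral_kernel_sq (l : ℕ) (x : S2) :
    ∫ y, kernel l x y ^ 2 ∂surfaceMeasure = 4 * Real.pi / (2 * l + 1) := by
  have := integral_zonal (fun t ↦ (legendre l).eval t ^ 2) (by fun_prop) (fun _ ↦ sq_nonneg _) x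
  rw [integral_legendre_sq] at this
  simp only [kernel]
  rw [this]; ring

lemma integral_abs_kernel_pow_three (l : ℕ) (x : S2) :
    ∫ y, |kernel l x y| ^ 3 ∂surfaceMeasure
      = 2 * Real.pi * ∫ t in (-1 : ℝ)..1, |(legendre l).eval t| ^ 3 :=
  integral_zonal (fun t ↦ |(legendre l).eval t| ^ 3) (by fun_prop) (fun _ ↦ by positivity) x

section Diagrams

/-! ### Integrals of products of kernels over quadruples of points -/

/-- Quadruples of points of the sphere, grouped in two pairs. -/
abbrev Quad : Type := (S2 × S2) × (S2 × S2)

/-- Product surface measure on pairs of points. -/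
noncomputable abbrev pairMeasure : Measure (S2 × S2) := surfaceMeasure.prod surfaceMeasure

/-- Product surface measure on quadruples of points. -/
noncomputable abbrev quadMeasure : Measure Quad := pairMeasure.prod pairMeasure

lemma measurePreserving_swap_snd :
    MeasurePreserving (fun z : Quad ↦ (z.1, z.2.swap)) quadMeasure quadMeasure :=
  (MeasurePreserving.id pairMeasure).prod Measure.measurePreserving_swap

lemma measurePreserving_swap_both :
    MeasurePreserving (fun z : Quad ↦ (z.1.swap, z.2.swap)) quadMeasure quadMeasure :=
  (Measure.measurePreserving_swap (μ := surfaceMeasure) (ν := surfaceMeasure)).prod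
    Measure.measurePreserving_swap

lemma measurePreserving_swap_middle :
    MeasurePreserving (fun z : Quad ↦ ((z.1.1, z.2.1), (z.1.2, z.2.2)))
      quadMeasure quadMeasure := by
  refine ⟨by fun_prop, Measure.ext_of_lintegral _ fun F hF ↦ ?_⟩
  rw [lintegral_map hF (by fun_prop), lintegral_prod _ (by fun_prop),
    lintegral_prod _ (by fun_prop), lintegral_prod _ (by fun_prop), lintegral_prod _ (by fun_prop)]
  refine lintegral_congr fun a ↦ ?_
  simp_rw [fun b : S2 ↦ lintegral_prod (μ := surfaceMeasure) (ν := surfaceMeasure)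
    (fun y : S2 × S2 ↦ F ((a, y.1), (b, y.2))) (by fun_prop),
    fun b : S2 ↦ lintegral_prod (μ := surfaceMeasure) (ν := surfaceMeasure)
    (fun y : S2 × S2 ↦ F ((a, b), y)) (by fun_prop)]
  refine lintegral_lintegral_swap (Measurable.aemeasurable ?_)
  exact Measurable.lintegral_prod_right' (f := fun p : (S2 × S2) × S2 ↦ F ((a, p.1.2), (p.1.1, p.2)))
    (by fun_prop)

lemma integrable_of_continuous {F : Quad → ℝ} (hF : Continuous F) : Integrable F quadMeasure :=
  hF.integrable_of_hasCompactSupport (HasCompactSupport.of_compactSpace F)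

variable (l : ℕ)

/-- The product of the kernels along the perfect matching `{12, 34}` of four points. -/
noncomputable def matchingA (z : Quad) : ℝ := kernel l z.1.1 z.1.2 * kernel l z.2.1 z.2.2

/-- The product of the kernels along the perfect matching `{13, 24}` of four points. -/
noncomputable def matchingB (z : Quad) : ℝ := kernel l z.1.1 z.2.1 * kernel l z.1.2 z.2.2

/-- The product of the kernels along the perfect matching `{14, 23}` of four points. -/
noncomputable def matchingC (z : Quad) : ℝ := kernel l z.1.1 z.2.2 * kernel l z.1.2 z.2.1

@[fun_prop] lemma continuous_matchingA : Continuous (matchingA l) := by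
  unfold matchingA; fun_prop

@[fun_prop] lemma continuous_matchingB : Continuous (matchingB l) := by
  unfold matchingB; fun_prop

@[fun_prop] lemma continuous_matchingC : Continuous (matchingC l) := by
  unfold matchingC; fun_prop

/-- The integral over four points attached to the multigraph on four vertices in which the edges of
the three perfect matchings have multiplicities `a`, `b`, `c`. -/
noncomputable def diagramIntegral (a b c : ℕ) : ℝ :=
  ∫ z, matchingA l z ^ a * matchingB l z ^ b * matchingC l z ^ c ∂quadMeasure

lemma integral_comp_of_measurePreserving {T : Quad → Quad}
    (hT : MeasurePreserving T quadMeasure quadMeasure)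
    {F : Quad → ℝ} (hF : Continuous F) : ∫ z, F (T z) ∂quadMeasure = ∫ z, F z ∂quadMeasure := by
  rw [← integral_map hT.measurable.aemeasurable (by exact hF.aestronglyMeasurable), hT.map_eq]

lemma integral_swap_BC (g : ℝ → ℝ → ℝ → ℝ) (hg : Continuous fun p : ℝ × ℝ × ℝ ↦ g p.1 p.2.1 p.2.2) :
    ∫ z, g (matchingA l z) (matchingC l z) (matchingB l z) ∂quadMeasure
      = ∫ z, g (matchingA l z) (matchingB l z) (matchingC l z) ∂quadMeasure := by
  have hc : Continuous fun z : Quad ↦ g (matchingA l z) (matchingB l z) (matchingC l z) :=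
    hg.comp (by fun_prop : Continuous fun z : Quad ↦ (matchingA l z, matchingB l z, matchingC l z))
  rw [← integral_comp_of_measurePreserving measurePreserving_swap_snd hc]
  refine integral_congr_ae (Filter.Eventually.of_forall fun z ↦ ?_)
  have e : matchingA l (z.1, z.2.swap) = matchingA l z := by
    simp [matchingA, kernel_comm l z.2.1]
  simp only [e]
  rfl

lemma integral_swap_AB (g : ℝ → ℝ → ℝ → ℝ) (hg : Continuous fun p : ℝ × ℝ × ℝ ↦ g p.1 p.2.1 p.2.2) :
    ∫ z, g (matchingB l z) (matchingA l z) (matchingC l z) ∂quadMeasure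
      = ∫ z, g (matchingA l z) (matchingB l z) (matchingC l z) ∂quadMeasure := by
  have hc : Continuous fun z : Quad ↦ g (matchingA l z) (matchingB l z) (matchingC l z) :=
    hg.comp (by fun_prop : Continuous fun z : Quad ↦ (matchingA l z, matchingB l z, matchingC l z))
  rw [← integral_comp_of_measurePreserving measurePreserving_swap_middle hc]
  refine integral_congr_ae (Filter.Eventually.of_forall fun z ↦ ?_)
  have e : matchingC l ((z.1.1, z.2.1), (z.1.2, z.2.2)) = matchingC l z := by
    simp [matchingC, kernel_comm l z.2.1]
  simp only [e]
  rfl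

lemma diagramIntegral_swap_right (a b c : ℕ) :
    diagramIntegral l a c b = diagramIntegral l a b c := by
  have := integral_swap_BC l (fun u v w ↦ u ^ a * v ^ b * w ^ c) (by fun_prop)
  rw [diagramIntegral, diagramIntegral, ← this]
  congr! 2 with z
  ring

lemma diagramIntegral_swap_left (a b c : ℕ) :
    diagramIntegral l b a c = diagramIntegral l a b c := by
  have := integral_swap_AB l (fun u v w ↦ u ^ a * v ^ b * w ^ c) (by fun_prop)
  rw [diagramIntegral, diagramIntegral, ← this]
  congr! 2 with z
  ring

/-- Fourfold edges give a disconnected diagram. -/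
lemma diagramIntegral_four :
    diagramIntegral l 4 0 0 = (∫ u, kernel l u.1 u.2 ^ 4 ∂pairMeasure) ^ 2 := by
  rw [sq, ← integral_prod_mul, diagramIntegral]
  congr! 2 with z
  simp [matchingA, mul_pow]

/-! ### Bounds for the diagram integrals -/

/-- The only graphs to be integrated are paths with three edges, whose integrals factorize. -/
lemma integral_path :
    ∫ z : Quad, |matchingA l z| ^ 3 * kernel l z.1.1 z.2.1 ^ 2 ∂quadMeasure
      = 4 * Real.pi * (2 * Real.pi * ∫ t in (-1 : ℝ)..1, |(legendre l).eval t| ^ 3) ^ 2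
        * (4 * Real.pi / (2 * l + 1)) := by
  have hc : Continuous fun z : Quad ↦ |matchingA l z| ^ 3 * kernel l z.1.1 z.2.1 ^ 2 := by fun_prop
  rw [integral_prod _ (integrable_of_continuous hc)]
  have hin : ∀ u : S2 × S2, ∫ v, |matchingA l (u, v)| ^ 3 * kernel l u.1 v.1 ^ 2 ∂pairMeasure
      = |kernel l u.1 u.2| ^ 3 * ((2 * Real.pi * ∫ t in (-1 : ℝ)..1, |(legendre l).eval t| ^ 3)
        * (4 * Real.pi / (2 * l + 1))) := by
    intro u
    have hc' : Continuous fun v : S2 × S2 ↦ |matchingA l (u, v)| ^ 3 * kernel l u.1 v.1 ^ 2 := by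
      fun_prop
    rw [integral_prod _ (hc'.integrable_of_hasCompactSupport (HasCompactSupport.of_compactSpace _))]
    simp only [matchingA, abs_mul, mul_pow]
    simp_rw [mul_right_comm _ _ (kernel l u.1 _ ^ 2), integral_const_mul,
      integral_abs_kernel_pow_three, integral_mul_const, integral_const_mul, integral_kernel_sq]
    ring
  simp only [hin]
  rw [integral_mul_const]
  have hc' : Continuous fun v : S2 × S2 ↦ |kernel l v.1 v.2| ^ 3 := by fun_prop
  rw [integral_prod _ (hc'.integrable_of_hasCompactSupport (HasCompactSupport.of_compactSpace _))]
  simp only [integral_abs_kernel_pow_three, integral_const, surfaceMeasure_real_univ, smul_eq_mul]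
  ring

lemma integral_path' :
    ∫ z : Quad, |matchingA l z| ^ 3 * kernel l z.1.2 z.2.2 ^ 2 ∂quadMeasure
      = ∫ z : Quad, |matchingA l z| ^ 3 * kernel l z.1.1 z.2.1 ^ 2 ∂quadMeasure := by
  have hc : Continuous fun z : Quad ↦ |matchingA l z| ^ 3 * kernel l z.1.1 z.2.1 ^ 2 := by fun_prop
  rw [← integral_comp_of_measurePreserving measurePreserving_swap_both hc]
  congr! 2 with z
  simp [matchingA, kernel_comm l z.1.1, kernel_comm l z.2.1]

/-- The four-cycle with multiplicities `3, 1, 3, 1` is dominated by the paths obtained by removing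
one of its simple edges. -/
lemma integral_abs_matching_le (hl : 1 ≤ l) :
    ∫ z, |matchingA l z| ^ 3 * |matchingB l z| ∂quadMeasure
      ≤ 2048 * Real.pi ^ 4 * (2 / (2 * (l : ℝ) + 1)) ^ 4 := by
  have h1 : ∫ z, |matchingA l z| ^ 3 * |matchingB l z| ∂quadMeasure
      ≤ ∫ z : Quad, (1 / 2 : ℝ) * (|matchingA l z| ^ 3 * kernel l z.1.1 z.2.1 ^ 2)
        + (1 / 2 : ℝ) * (|matchingA l z| ^ 3 * kernel l z.1.2 z.2.2 ^ 2) ∂quadMeasure := by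
    refine integral_mono (integrable_of_continuous (by fun_prop))
      (integrable_of_continuous (by fun_prop)) fun z ↦ ?_
    have h : |matchingB l z| ≤ 1 / 2 * kernel l z.1.1 z.2.1 ^ 2 + 1 / 2 * kernel l z.1.2 z.2.2 ^ 2 := by
      rw [matchingB, abs_mul, ← sq_abs (kernel l z.1.1 z.2.1), ← sq_abs (kernel l z.1.2 z.2.2)]
      nlinarith [sq_nonneg (|kernel l z.1.1 z.2.1| - |kernel l z.1.2 z.2.2|)]
    have := mul_le_mul_of_nonneg_left h (pow_nonneg (abs_nonneg (matchingA l z)) 3)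
    linarith
  rw [integral_add (integrable_of_continuous (by fun_prop)) (integrable_of_continuous (by fun_prop)),
    integral_const_mul, integral_const_mul, integral_path', integral_path] at h1
  refine h1.trans ?_
  have h2 := integral_abs_legendre_pow_three_le l hl
  have h0 : 0 ≤ ∫ t in (-1 : ℝ)..1, |(legendre l).eval t| ^ 3 :=
    intervalIntegral.integral_nonneg (by norm_num) fun _ _ ↦ by positivity
  have h3 := pow_le_pow_left₀ h0 h2 2
  have hJ : 0 ≤ 2 / (2 * (l : ℝ) + 1) := by positivity
  have h4 : (8 * √(2 / (2 * (l : ℝ) + 1)) ^ 3) ^ 2 = 64 * (2 / (2 * (l : ℝ) + 1)) ^ 3 := by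
    rw [mul_pow, ← pow_mul, mul_comm 3 2, pow_mul, Real.sq_sqrt hJ]; norm_num
  rw [h4] at h3
  have e : 4 * Real.pi / (2 * (l : ℝ) + 1) = 2 * Real.pi * (2 / (2 * (l : ℝ) + 1)) := by ring
  rw [e]
  set J := 2 / (2 * (l : ℝ) + 1)
  have h5 := mul_le_mul_of_nonneg_left h3 (by positivity : 0 ≤ 32 * Real.pi ^ 4 * J)
  linarith

lemma diagramIntegral_three_one_le :
    diagramIntegral l 3 1 0 ≤ ∫ z, |matchingA l z| ^ 3 * |matchingB l z| ∂quadMeasure := by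
  refine integral_mono (integrable_of_continuous (by fun_prop))
    (integrable_of_continuous (by fun_prop)) fun z ↦ ?_
  simp only [pow_one, pow_zero, mul_one, ← abs_pow, ← abs_mul]
  exact le_abs_self _

/-- By the inequality `2 a² b² ≤ a³ b + a b³`, doubled edges are dominated by multiplicities
`3, 1, 3, 1`. -/
lemma diagramIntegral_two_two_le :
    diagramIntegral l 2 2 0 ≤ ∫ z, |matchingA l z| ^ 3 * |matchingB l z| ∂quadMeasure := by
  have h1 : diagramIntegral l 2 2 0 ≤ ∫ z, (1 / 2 : ℝ) * (|matchingA l z| ^ 3 * |matchingB l z|)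
      + (1 / 2 : ℝ) * (|matchingB l z| ^ 3 * |matchingA l z|) ∂quadMeasure := by
    refine integral_mono (integrable_of_continuous (by fun_prop))
      (integrable_of_continuous (by fun_prop)) fun z ↦ ?_
    simp only [pow_zero, mul_one]
    rw [← sq_abs (matchingA l z), ← sq_abs (matchingB l z)]
    have := mul_nonneg (mul_nonneg (abs_nonneg (matchingA l z)) (abs_nonneg (matchingB l z)))
      (sq_nonneg (|matchingA l z| - |matchingB l z|))
    linarith
  rw [integral_add (integrable_of_continuous (by fun_prop)) (integrable_of_continuous (by fun_prop)),
    integral_const_mul, integral_const_mul,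
    integral_swap_AB l (fun u v _ ↦ |u| ^ 3 * |v|) (by fun_prop)] at h1
  linarith

lemma diagramIntegral_two_one_one_le :
    diagramIntegral l 2 1 1 ≤ diagramIntegral l 2 2 0 := by
  have h1 : diagramIntegral l 2 1 1 ≤ ∫ z, (1 / 2 : ℝ) * (matchingA l z ^ 2 * matchingB l z ^ 2 *
      matchingC l z ^ 0) + (1 / 2 : ℝ) * (matchingA l z ^ 2 * matchingB l z ^ 0 *
      matchingC l z ^ 2) ∂quadMeasure := by
    refine integral_mono (integrable_of_continuous (by fun_prop))
      (integrable_of_continuous (by fun_prop)) fun z ↦ ?_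
    have := mul_nonneg (sq_nonneg (matchingA l z)) (sq_nonneg (matchingB l z - matchingC l z))
    simp only [pow_zero, mul_one, pow_one]
    linarith
  rw [integral_add (integrable_of_continuous (by fun_prop)) (integrable_of_continuous (by fun_prop)),
    integral_const_mul, integral_const_mul] at h1
  have h2 := diagramIntegral_swap_right l 2 2 0
  simp only [diagramIntegral] at h1 h2 ⊢
  linarith

/-- The lower bound for the four-cycle with all edges doubled: in operator terms, the contribution
of constant functions to the trace of the fourth power of the operator with kernel `K²`. -/
lemma le_diagramIntegral_two_two :
    (4 * Real.pi / (2 * (l : ℝ) + 1)) ^ 4 ≤ diagramIntegral l 2 2 0 := by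
  rw [← diagramIntegral_swap_right, diagramIntegral_swap_left l 0 2 2]
  set κ : ℝ := 4 * Real.pi / (2 * (l : ℝ) + 1) with hκ
  set G : S2 × S2 → ℝ := fun u ↦ ∫ y, kernel l u.1 y ^ 2 * kernel l u.2 y ^ 2 ∂surfaceMeasure
    with hG
  have hin : ∀ u : S2 × S2, ∫ v, matchingA l (u, v) ^ 0 * matchingB l (u, v) ^ 2 *
      matchingC l (u, v) ^ 2 ∂pairMeasure = G u ^ 2 := by
    intro u
    rw [hG, sq (∫ y, _ ∂_), ← integral_prod_mul]
    refine integral_congr_ae (Filter.Eventually.of_forall fun v ↦ ?_)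
    simp only [matchingB, matchingC]
    ring
  have hI : Integrable (fun z : Quad ↦ matchingA l z ^ 0 * matchingB l z ^ 2 *
      matchingC l z ^ 2) quadMeasure := integrable_of_continuous (by fun_prop)
  have hG2 : Integrable (fun u ↦ G u ^ 2) pairMeasure := by
    simpa only [hin] using hI.integral_prod_left
  have hc : Continuous fun p : (S2 × S2) × S2 ↦ kernel l p.1.1 p.2 ^ 2 * kernel l p.1.2 p.2 ^ 2 := by
    fun_prop
  have hI1 : Integrable (fun p : (S2 × S2) × S2 ↦ kernel l p.1.1 p.2 ^ 2 * kernel l p.1.2 p.2 ^ 2)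
      (pairMeasure.prod surfaceMeasure) :=
    hc.integrable_of_hasCompactSupport (HasCompactSupport.of_compactSpace _)
  have hG1 : Integrable G pairMeasure := hI1.integral_prod_left
  have hGint : ∫ u, G u ∂pairMeasure = 4 * Real.pi * κ ^ 2 := by
    rw [hG, integral_integral_swap hI1]
    have : ∀ y : S2, ∫ u : S2 × S2, kernel l u.1 y ^ 2 * kernel l u.2 y ^ 2 ∂pairMeasure
        = κ ^ 2 := by
      intro y
      rw [integral_prod_mul (fun x ↦ kernel l x y ^ 2) (fun x ↦ kernel l x y ^ 2)]
      simp only [kernel_comm l _ y, integral_kernel_sq]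
      rw [sq]
    simp only [this, integral_const, surfaceMeasure_real_univ, smul_eq_mul]
  rw [diagramIntegral, integral_prod _ hI]
  simp only [hin]
  set m : ℝ := κ ^ 2 / (4 * Real.pi) with hm
  have huniv : pairMeasure.real Set.univ = (4 * Real.pi) ^ 2 := by
    rw [← Set.univ_prod_univ, measureReal_prod_prod, surfaceMeasure_real_univ, sq]
  have hle : ∫ u, (2 * m * G u - m ^ 2) ∂pairMeasure ≤ ∫ u, G u ^ 2 ∂pairMeasure := by
    refine integral_mono ((hG1.const_mul _).sub (integrable_const _)) hG2 fun u ↦ ?_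
    have := sq_nonneg (G u - m)
    simp only
    linarith
  rw [integral_sub (hG1.const_mul _) (integrable_const _), integral_const_mul, hGint,
    integral_const, huniv, smul_eq_mul] at hle
  refine le_trans (le_of_eq ?_) hle
  rw [hm]
  field_simp
  ring

end Diagrams

section Positivity

/-! ### Positivity of symmetrized kernels -/

lemma integrable_uncurry_of_integral_abs_le {A Ω : Type*} [MeasurableSpace A] [MeasurableSpace Ω]
    {m : Measure A} [IsFiniteMeasure m] {P : Measure Ω} [SFinite P] {F : A → Ω → ℝ}
    (hm : Measurable (Function.uncurry F)) (hF : ∀ a, Integrable (F a) P) (C : ℝ)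
    (hC : ∀ a, ∫ ω, |F a ω| ∂P ≤ C) : Integrable (Function.uncurry F) (m.prod P) := by
  refine (integrable_prod_iff hm.aestronglyMeasurable).2 ⟨Filter.Eventually.of_forall hF, ?_⟩
  refine Integrable.mono' (integrable_const C) hm.aestronglyMeasurable.norm.integral_prod_right'
    (Filter.Eventually.of_forall fun a ↦ ?_)
  rw [Real.norm_of_nonneg (integral_nonneg fun _ ↦ norm_nonneg _)]
  exact hC a

/-- The two points of a pair, indexed by `Fin 2`. -/
def point (u : S2 × S2) (i : Fin 2) : S2 := if i = 0 then u.1 else u.2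

lemma point_zero (u : S2 × S2) : point u 0 = u.1 := rfl

lemma point_one (u : S2 × S2) : point u 1 = u.2 := rfl

lemma measurable_point (i : Fin 2) : Measurable fun u : S2 × S2 ↦ point u i := by
  unfold point
  split_ifs <;> fun_prop

variable {l : ℕ} {Ω : Type*} [MeasurableSpace Ω] {P : Measure Ω} {f : S2 → Ω → ℝ}

lemma IsGaussianEigenfunction.memLp (hf : IsGaussianEigenfunction l P f) (x : S2) {p : ℝ≥0∞}
    (hp : p ≠ ∞) : MemLp (f x) p P :=
  (hf.isGaussianProcess.hasGaussianLaw_eval x).memLp hp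

lemma IsGaussianEigenfunction.integral_mul (hf : IsGaussianEigenfunction l P f) (x y : S2) :
    ∫ ω, f x ω * f y ω ∂P = kernel l x y := hf.covariance_eq x y

lemma IsGaussianEigenfunction.integrable_mul (hf : IsGaussianEigenfunction l P f) (x y : S2) :
    Integrable (fun ω ↦ f x ω * f y ω) P :=
  (hf.memLp x (p := 2) (by simp)).integrable_mul (hf.memLp y (p := 2) (by simp))

lemma IsGaussianEigenfunction.integral_abs_mul_le (hf : IsGaussianEigenfunction l P f) (x y : S2) :
    ∫ ω, |f x ω * f y ω| ∂P ≤ 1 := by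
  have h : ∫ ω, |f x ω * f y ω| ∂P ≤ ∫ ω, (1 / 2 * (f x ω * f x ω) + 1 / 2 * (f y ω * f y ω)) ∂P := by
    refine integral_mono (hf.integrable_mul x y).abs
      (((hf.integrable_mul x x).const_mul _).add ((hf.integrable_mul y y).const_mul _)) fun ω ↦ ?_
    simp only [abs_mul]
    have := sq_nonneg (|f x ω| - |f y ω|)
    rw [← abs_mul_abs_self (f x ω), ← abs_mul_abs_self (f y ω)]
    linarith
  rw [integral_add ((hf.integrable_mul x x).const_mul _) ((hf.integrable_mul y y).const_mul _),
    integral_const_mul, integral_const_mul, hf.integral_mul, hf.integral_mul, kernel_self,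
    kernel_self] at h
  linarith

variable [IsProbabilityMeasure P]

/-- Let the tensor `e_u = ∑_{σ ∈ S} e_{u(σ 1)} ⊗ ⋯ ⊗ e_{u(σ n)}`, where `e_x = f x` as an element of
`L²(P)`, be attached to a pair of points `u`. The inner products `⟨e_u, e_v⟩` form a positive
semidefinite kernel, whose integral against `w(u) w(v)` is `‖∫ w(u) e_u du‖² ≥ 0`. -/
lemma IsGaussianEigenfunction.integral_symmetrized_nonneg (hf : IsGaussianEigenfunction l P f)
    {n : ℕ} (S : Finset (Fin n → Fin 2)) (w : S2 × S2 → ℝ) (hw : Continuous w) :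
    0 ≤ ∫ z : Quad, w z.1 * w z.2 *
      ∑ σ ∈ S, ∑ τ ∈ S, ∏ k, kernel l (point z.1 (σ k)) (point z.2 (τ k)) ∂quadMeasure := by
  set Q : Measure (Fin n → Ω) := Measure.pi fun _ ↦ P
  set φ : S2 × S2 → (Fin n → Ω) → ℝ := fun u ω ↦ w u * ∑ σ ∈ S, ∏ k, f (point u (σ k)) (ω k)
    with hφ
  have hexp : ∀ (z : Quad) ω, φ z.1 ω * φ z.2 ω = ∑ σ ∈ S, ∑ τ ∈ S, w z.1 * w z.2 *
      ∏ k, (f (point z.1 (σ k)) (ω k) * f (point z.2 (τ k)) (ω k)) := by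
    intro z ω
    simp only [hφ]
    rw [mul_mul_mul_comm, Finset.sum_mul_sum, Finset.mul_sum]
    refine Finset.sum_congr rfl fun σ _ ↦ ?_
    rw [Finset.mul_sum]
    refine Finset.sum_congr rfl fun τ _ ↦ ?_
    rw [Finset.prod_mul_distrib]
  have hterm : ∀ (σ τ : Fin n → Fin 2) (z : Quad), Integrable (fun ω : Fin n → Ω ↦ w z.1 * w z.2 *
      ∏ k, (f (point z.1 (σ k)) (ω k) * f (point z.2 (τ k)) (ω k))) Q := fun σ τ z ↦
    (Integrable.fintype_prod_dep fun k ↦ hf.integrable_mul _ _).const_mul _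
  obtain ⟨C, hC⟩ : ∃ C, ∀ u, |w u| ≤ C := by
    obtain ⟨C, hC⟩ := isCompact_univ.exists_bound_of_continuousOn hw.continuousOn
    exact ⟨C, fun u ↦ hC u trivial⟩
  have hjoint : ∀ σ τ : Fin n → Fin 2, Integrable (fun p : Quad × (Fin n → Ω) ↦ w p.1.1 * w p.1.2 *
      ∏ k, (f (point p.1.1 (σ k)) (p.2 k) * f (point p.1.2 (τ k)) (p.2 k)))
      (quadMeasure.prod Q) := by
    intro σ τ
    have hwm := hw.measurable
    have hfm : ∀ (i : Fin 2) (k : Fin n), Measurable fun p : Quad × (Fin n → Ω) ↦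
        f (point p.1.1 i) (p.2 k) := fun i k ↦ hf.measurable_uncurry.comp
      (((measurable_point i).comp (by fun_prop : Measurable fun p : Quad × (Fin n → Ω) ↦ p.1.1)).prodMk
        (by fun_prop))
    have hfm' : ∀ (i : Fin 2) (k : Fin n), Measurable fun p : Quad × (Fin n → Ω) ↦
        f (point p.1.2 i) (p.2 k) := fun i k ↦ hf.measurable_uncurry.comp
      (((measurable_point i).comp (by fun_prop : Measurable fun p : Quad × (Fin n → Ω) ↦ p.1.2)).prodMk
        (by fun_prop))
    have hm : Measurable (fun p : Quad × (Fin n → Ω) ↦ w p.1.1 * w p.1.2 *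
      ∏ k, (f (point p.1.1 (σ k)) (p.2 k) * f (point p.1.2 (τ k)) (p.2 k))) := by
      refine Measurable.mul (by fun_prop) (Finset.measurable_prod _ fun k _ ↦ (hfm _ _).mul (hfm' _ _))
    refine integrable_uncurry_of_integral_abs_le (F := fun (z : Quad) (ω : Fin n → Ω) ↦
      w z.1 * w z.2 * ∏ k, (f (point z.1 (σ k)) (ω k) * f (point z.2 (τ k)) (ω k)))
      hm (hterm σ τ) (C * C) fun z ↦ ?_
    simp only [abs_mul, Finset.abs_prod]
    rw [integral_const_mul, integral_fintype_prod_eq_prod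
      (f := fun k ω ↦ |f (point z.1 (σ k)) ω| * |f (point z.2 (τ k)) ω|)]
    have h1 : ∏ k, ∫ ω, |f (point z.1 (σ k)) ω| * |f (point z.2 (τ k)) ω| ∂P ≤ 1 := by
      refine Finset.prod_le_one (fun k _ ↦ integral_nonneg fun _ ↦ by positivity) fun k _ ↦ ?_
      simpa only [abs_mul] using hf.integral_abs_mul_le (point z.1 (σ k)) (point z.2 (τ k))
    have h2 : |w z.1| * |w z.2| ≤ C * C :=
      mul_le_mul (hC _) (hC _) (abs_nonneg _) ((abs_nonneg _).trans (hC z.1))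
    exact (mul_le_of_le_one_right (by positivity) h1).trans h2
  have hsum : Integrable (Function.uncurry fun (z : Quad) ω ↦ φ z.1 ω * φ z.2 ω)
      (quadMeasure.prod Q) := by
    simp only [Function.uncurry_def, hexp]
    exact integrable_finsetSum _ fun σ _ ↦ integrable_finsetSum _ fun τ _ ↦ hjoint σ τ
  have hkey : ∀ z : Quad, w z.1 * w z.2 *
      ∑ σ ∈ S, ∑ τ ∈ S, ∏ k, kernel l (point z.1 (σ k)) (point z.2 (τ k))
      = ∫ ω, φ z.1 ω * φ z.2 ω ∂Q := by
    intro z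
    simp only [hexp]
    rw [integral_finsetSum _ fun σ _ ↦ integrable_finsetSum _ fun τ _ ↦ hterm σ τ z,
      Finset.mul_sum]
    refine Finset.sum_congr rfl fun σ _ ↦ ?_
    rw [integral_finsetSum _ fun τ _ ↦ hterm σ τ z, Finset.mul_sum]
    refine Finset.sum_congr rfl fun τ _ ↦ ?_
    rw [integral_const_mul, integral_fintype_prod_eq_prod
      (f := fun k ω ↦ f (point z.1 (σ k)) ω * f (point z.2 (τ k)) ω)]
    simp only [hf.integral_mul]
  simp only [hkey]
  rw [integral_integral_swap hsum]
  refine integral_nonneg fun ω ↦ ?_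
  simp only [Pi.zero_apply]
  rw [integral_prod_mul (fun u ↦ φ u ω) (fun u ↦ φ u ω)]
  exact mul_self_nonneg _

/-- The tensors used here are `K(x₁, x₂)³ e₁ ⊗ e₂`. -/
lemma IsGaussianEigenfunction.diagramIntegral_three_one_nonneg
    (hf : IsGaussianEigenfunction l P f) : 0 ≤ diagramIntegral l 3 1 0 := by
  have h := hf.integral_symmetrized_nonneg {![0, 1]} (fun u ↦ kernel l u.1 u.2 ^ 3) (by fun_prop)
  refine h.trans (le_of_eq ?_)
  rw [diagramIntegral]
  refine integral_congr_ae (Filter.Eventually.of_forall fun z ↦ ?_)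
  simp only [Finset.sum_singleton, Fin.prod_univ_two, Matrix.cons_val, point_zero, point_one,
    matchingA, matchingB]
  ring

/-- The tensors used here are `K(x₁, x₂)` times `e₁ ⊗ e₂ ⊗ (e₁ ⊗ e₁ ⊗ e₂ ⊗ e₂)`,
symmetrized in the last four factors. -/
lemma IsGaussianEigenfunction.diagramIntegral_combination_nonneg
    (hf : IsGaussianEigenfunction l P f) :
    0 ≤ diagramIntegral l 3 1 0 + 5 * diagramIntegral l 2 1 1 := by
  have h := hf.integral_symmetrized_nonneg {![0, 1, 0, 0, 1, 1], ![0, 1, 0, 1, 0, 1],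
    ![0, 1, 0, 1, 1, 0], ![0, 1, 1, 0, 0, 1], ![0, 1, 1, 0, 1, 0], ![0, 1, 1, 1, 0, 0]}
    (fun u ↦ kernel l u.1 u.2) (by fun_prop)
  have e : ∀ z : Quad, kernel l z.1.1 z.1.2 * kernel l z.2.1 z.2.2 *
      ∑ σ ∈ ({![0, 1, 0, 0, 1, 1], ![0, 1, 0, 1, 0, 1], ![0, 1, 0, 1, 1, 0], ![0, 1, 1, 0, 0, 1],
        ![0, 1, 1, 0, 1, 0], ![0, 1, 1, 1, 0, 0]} : Finset (Fin 6 → Fin 2)),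
      ∑ τ ∈ ({![0, 1, 0, 0, 1, 1], ![0, 1, 0, 1, 0, 1], ![0, 1, 0, 1, 1, 0], ![0, 1, 1, 0, 0, 1],
        ![0, 1, 1, 0, 1, 0], ![0, 1, 1, 1, 0, 0]} : Finset (Fin 6 → Fin 2)),
      ∏ k, kernel l (point z.1 (σ k)) (point z.2 (τ k)) =
      6 * (matchingA l z ^ 1 * matchingB l z ^ 3 * matchingC l z ^ 0)
      + 24 * (matchingA l z ^ 1 * matchingB l z ^ 2 * matchingC l z ^ 1)
      + 6 * (matchingA l z ^ 1 * matchingB l z ^ 1 * matchingC l z ^ 2) := by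
    intro z
    have h1 : ∀ s : Fin 6 → Fin 2 → ℝ, ∑ σ ∈ ({![0, 1, 0, 0, 1, 1], ![0, 1, 0, 1, 0, 1],
        ![0, 1, 0, 1, 1, 0], ![0, 1, 1, 0, 0, 1],
        ![0, 1, 1, 0, 1, 0], ![0, 1, 1, 1, 0, 0]} : Finset (Fin 6 → Fin 2)), ∏ k, s k (σ k)
        = s 0 0 * s 1 1 * (s 2 0 * s 3 0 * s 4 1 * s 5 1 + s 2 0 * s 3 1 * s 4 0 * s 5 1
          + s 2 0 * s 3 1 * s 4 1 * s 5 0 + s 2 1 * s 3 0 * s 4 0 * s 5 1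
          + s 2 1 * s 3 0 * s 4 1 * s 5 0 + s 2 1 * s 3 1 * s 4 0 * s 5 0) := by
      intro s
      rw [Finset.sum_insert (by decide), Finset.sum_insert (by decide),
        Finset.sum_insert (by decide), Finset.sum_insert (by decide),
        Finset.sum_insert (by decide), Finset.sum_singleton]
      simp only [Fin.prod_univ_six, Matrix.cons_val]
      ring
    simp_rw [fun σ : Fin 6 → Fin 2 ↦ h1 fun k i ↦ kernel l (point z.1 (σ k)) (point z.2 i)]
    rw [Finset.sum_insert (by decide), Finset.sum_insert (by decide),
        Finset.sum_insert (by decide), Finset.sum_insert (by decide),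
        Finset.sum_insert (by decide), Finset.sum_singleton]
    simp only [Matrix.cons_val]
    simp only [point_zero, point_one, matchingA, matchingB, matchingC]
    ring
  simp only [e] at h
  rw [integral_add (integrable_of_continuous (by fun_prop)) (integrable_of_continuous (by fun_prop)),
    integral_add (integrable_of_continuous (by fun_prop)) (integrable_of_continuous (by fun_prop)),
    integral_const_mul, integral_const_mul, integral_const_mul] at h
  have h2 := diagramIntegral_swap_left l 3 1 0
  have h3 := diagramIntegral_swap_left l 2 1 1
  have h4 := diagramIntegral_swap_right l 1 1 2
  simp only [diagramIntegral] at h h2 h3 h4 ⊢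
  linarith

end Positivity

/-! ### Gaussian integration by parts -/

lemma integrable_polynomial_gaussianReal (q : ℝ[X]) (m : ℝ) (v : NNReal) :
    Integrable (fun x ↦ q.eval x) (gaussianReal m v) := by
  induction q using Polynomial.induction_on' with
  | add p q hp hq => simp only [eval_add]; exact hp.add hq
  | monomial n a =>
    simp only [eval_monomial]
    refine Integrable.const_mul ?_ a
    have := (memLp_id_gaussianReal' (μ := m) (v := v) n (by simp)).integrable_norm_pow'
    refine this.mono' (by fun_prop) (Filter.Eventually.of_forall fun x ↦ ?_)
    simp

/-- Stein's identity for polynomials. -/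
lemma integral_id_mul_polynomial_gaussianReal (q : ℝ[X]) :
    ∫ x, x * q.eval x ∂(gaussianReal 0 1) = ∫ x, (derivative q).eval x ∂(gaussianReal 0 1) := by
  have hint : ∀ q : ℝ[X], Integrable (fun x ↦ gaussianPDFReal 0 1 x * q.eval x) := by
    intro q
    have := integrable_polynomial_gaussianReal q 0 1
    rw [gaussianReal_of_var_ne_zero 0 one_ne_zero, integrable_withDensity_iff_integrable_smul'
      (measurable_gaussianPDF 0 1) (Filter.Eventually.of_forall fun _ ↦ gaussianPDF_lt_top)] at this
    simpa only [toReal_gaussianPDF, smul_eq_mul] using this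
  have hd : ∀ x, HasDerivAt (fun x ↦ gaussianPDFReal 0 1 x * q.eval x)
      (gaussianPDFReal 0 1 x * (derivative q - X * q).eval x) x := by
    intro x
    have h1 : HasDerivAt (gaussianPDFReal 0 1) (-x * gaussianPDFReal 0 1 x) x := by
      have := ((((hasDerivAt_id x).sub_const 0).pow 2).neg.div_const (2 * (1 : ℝ))).exp.const_mul
        (√(2 * Real.pi * (1 : ℝ)))⁻¹
      convert! this using 1
      simp [gaussianPDFReal]
      ring
    refine (h1.mul (q.hasDerivAt x)).congr_deriv ?_
    simp
    ring
  have h0 := integral_eq_zero_of_hasDerivAt_of_integrable hd (hint _) (hint _)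
  rw [integral_gaussianReal_eq_integral_smul one_ne_zero,
    integral_gaussianReal_eq_integral_smul one_ne_zero, ← sub_eq_zero, ← neg_eq_zero, neg_sub]
  have e : ∀ x, x * eval x q = eval x (X * q) := by simp
  simp only [smul_eq_mul, e]
  rw [← integral_sub (hint _) (hint _)]
  refine Eq.trans (integral_congr_ae (Filter.Eventually.of_forall fun x ↦ ?_)) h0
  simp only [eval_sub]; ring

section Wick

variable {Ω : Type*} [MeasurableSpace Ω] {P : Measure Ω}

/-- Random variables with moments of all orders are closed under multiplication. -/
lemma memLp_mul_of_forall {g h : Ω → ℝ} (hg : ∀ p : ℝ≥0∞, p ≠ ∞ → MemLp g p P)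
    (hh : ∀ p : ℝ≥0∞, p ≠ ∞ → MemLp h p P) :
    ∀ p : ℝ≥0∞, p ≠ ∞ → MemLp (fun ω ↦ g ω * h ω) p P := by
  intro p hp
  have hp2 : 2 * p ≠ ∞ := ENNReal.mul_ne_top (by simp) hp
  have : ENNReal.HolderTriple (2 * p) (2 * p) p := ⟨by
    rw [ENNReal.mul_inv (by simp) (by simp), ← add_mul, ENNReal.inv_two_add_inv_two, one_mul]⟩
  exact (hh _ hp2).mul' (hg _ hp2)

variable [IsProbabilityMeasure P]

lemma memLp_polynomial_of_forall {g : Ω → ℝ} (hg : ∀ p : ℝ≥0∞, p ≠ ∞ → MemLp g p P) (q : ℝ[X]) :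
    ∀ p : ℝ≥0∞, p ≠ ∞ → MemLp (fun ω ↦ q.eval (g ω)) p P := by
  induction q using Polynomial.induction_on with
  | C a => intro p _; simpa using memLp_const a
  | add q r hq hr => intro p hp; simp only [eval_add]; exact (hq p hp).add (hr p hp)
  | monomial n a ih =>
    intro p hp
    simpa [pow_succ, ← mul_assoc] using memLp_mul_of_forall ih hg p hp

lemma memLp_prod_of_forall {ι : Type*} (s : Finset ι) {g : ι → Ω → ℝ}
    (hg : ∀ i, ∀ p : ℝ≥0∞, p ≠ ∞ → MemLp (g i) p P) :
    ∀ p : ℝ≥0∞, p ≠ ∞ → MemLp (fun ω ↦ ∏ i ∈ s, g i ω) p P := by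
  classical
  induction s using Finset.induction_on with
  | empty => intro p _; simpa using memLp_const (1 : ℝ)
  | insert i s hi ih =>
    simp only [Finset.prod_insert hi]
    exact memLp_mul_of_forall (hg i) ih

variable {ι : Type*} [Fintype ι] [DecidableEq ι] {Y : ι → Ω → ℝ}

/-- **Gaussian integration by parts** for products of polynomials of the coordinates of a centred
Gaussian vector, with respect to a coordinate of unit variance. The residuals
`Y j - E[Y i * Y j] * Y i` are independent of `Y i`, so that this follows from the one-dimensional
identity conditionally on the residuals. -/
lemma integral_mul_prod_polynomial (hY : IsGaussianProcess Y P) (h0 : ∀ i, ∫ ω, Y i ω ∂P = 0)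
    (i : ι) (hi : ∫ ω, Y i ω * Y i ω ∂P = 1) (q : ι → ℝ[X]) :
    ∫ ω, Y i ω * ∏ j, (q j).eval (Y j ω) ∂P
      = ∑ j, (∫ ω, Y i ω * Y j ω ∂P) *
        ∫ ω, (derivative (q j)).eval (Y j ω) * ∏ k ∈ Finset.univ.erase j, (q k).eval (Y k ω) ∂P := by
  set c : ι → ℝ := fun j ↦ ∫ ω, Y i ω * Y j ω ∂P with hc
  have hmem : ∀ j, ∀ p : ℝ≥0∞, p ≠ ∞ → MemLp (Y j) p P :=
    fun j p hp ↦ (hY.hasGaussianLaw_eval j).memLp hp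
  have hmul : ∀ j k, Integrable (fun ω ↦ Y j ω * Y k ω) P := fun j k ↦
    (hmem j 2 (by simp)).integrable_mul (hmem k 2 (by simp))
  set U : ι → Ω → ℝ := fun j ω ↦ Y j ω - c j * Y i ω with hU
  have hUm : ∀ j, AEMeasurable (U j) P := fun j ↦
    (hY.aemeasurable j).sub ((hY.aemeasurable i).const_mul _)
  have hlaw : P.map (Y i) = gaussianReal 0 1 := by
    rw [(hY.hasGaussianLaw_eval i).map_eq_gaussianReal, h0, variance_eq_sub (hmem i 2 (by simp))]
    simp only [h0, Pi.pow_apply, sq]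
    simp [hi]
  have hind : IndepFun (fun ω (_ : Unit) ↦ Y i ω) (fun ω j ↦ U j ω) P := by
    refine IsGaussianProcess.indepFun_of_covariance_eq_zero (X := fun _ : Unit ↦ Y i) (Y := U)
      ?_ (fun _ ↦ hY.aemeasurable i) hUm ?_
    · refine hY.of_isGaussianProcess fun s ↦ ?_
      rcases s with s | j
      · refine ⟨Finset.univ, ContinuousLinearMap.proj ⟨i, Finset.mem_univ _⟩, fun ω ↦ rfl⟩
      · refine ⟨Finset.univ, ContinuousLinearMap.proj ⟨j, Finset.mem_univ _⟩
          - c j • ContinuousLinearMap.proj ⟨i, Finset.mem_univ _⟩, fun ω ↦ rfl⟩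
    · intro _ j
      have hUj : MemLp (U j) 2 P := (hmem j 2 (by simp)).sub ((hmem i 2 (by simp)).const_mul _)
      rw [covariance_eq_sub (hmem i 2 (by simp)) hUj, h0, zero_mul, sub_zero]
      have : ∀ ω, (Y i * U j) ω = Y i ω * Y j ω - c j * (Y i ω * Y i ω) := by
        intro ω; simp only [hU, Pi.mul_apply]; ring
      simp only [this]
      rw [integral_sub (hmul _ _) ((hmul _ _).const_mul _), integral_const_mul, hi]
      simp [hc]
  have hind2 : IndepFun (Y i) (fun ω j ↦ U j ω) P :=
    hind.comp (φ := fun g : Unit → ℝ ↦ g ()) (ψ := id) (by fun_prop) measurable_id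
  have hUm' : AEMeasurable (fun ω j ↦ U j ω) P := aemeasurable_pi_lambda _ hUm
  have hpair := (indepFun_iff_map_prod_eq_prod_map_map (hY.aemeasurable i) hUm').1 hind2
  rw [hlaw] at hpair
  set ν : Measure (ι → ℝ) := P.map fun ω j ↦ U j ω with hν
  have : IsProbabilityMeasure ν := Measure.isProbabilityMeasure_map hUm'
  have hpm : AEMeasurable (fun ω ↦ (Y i ω, fun j ↦ U j ω)) P := (hY.aemeasurable i).prodMk hUm'
  -- the product, as a polynomial in the value of `Y i`, given the residuals
  set R : (ι → ℝ) → ℝ[X] := fun u ↦ ∏ j, (q j).comp (C (c j) * X + C (u j)) with hR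
  have hRe : ∀ u z, (R u).eval z = ∏ j, (q j).eval (c j * z + u j) := by
    intro u z; simp [hR, eval_prod, eval_comp]
  have hRd : ∀ u z, (derivative (R u)).eval z = ∑ j, c j * ((derivative (q j)).eval (c j * z + u j) *
      ∏ k ∈ Finset.univ.erase j, (q k).eval (c k * z + u k)) := by
    intro u z
    simp only [hR]
    rw [derivative_prod_finset, eval_finsetSum]
    refine Finset.sum_congr rfl fun j _ ↦ ?_
    simp [eval_prod, eval_comp, derivative_comp]
    ring
  have hback : ∀ j ω, c j * Y i ω + U j ω = Y j ω := by intro j ω; simp [hU]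
  have htransfer : ∀ G : ℝ × (ι → ℝ) → ℝ, Continuous G →
      Integrable (fun ω ↦ G (Y i ω, fun j ↦ U j ω)) P →
      ∫ ω, G (Y i ω, fun j ↦ U j ω) ∂P = ∫ u, ∫ z, G (z, u) ∂(gaussianReal 0 1) ∂ν := by
    intro G hG hGi
    rw [← integral_prod_symm _ (by
      rw [← hpair]
      exact (integrable_map_measure (by exact hG.aestronglyMeasurable) hpm).2 hGi), ← hpair,
      integral_map hpm (by exact hG.aestronglyMeasurable)]
  have hterm : ∀ j, Integrable (fun ω ↦ (derivative (q j)).eval (Y j ω) *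
      ∏ k ∈ Finset.univ.erase j, (q k).eval (Y k ω)) P := fun j ↦
    memLp_one_iff_integrable.1 (memLp_mul_of_forall (memLp_polynomial_of_forall (hmem j) _)
      (memLp_prod_of_forall _ fun k ↦ memLp_polynomial_of_forall (hmem k) (q k)) 1 (by simp))
  have h1 := htransfer (fun p ↦ p.1 * ∏ j, (q j).eval (c j * p.1 + p.2 j)) (by fun_prop) (by
    simp only [hback]
    exact memLp_one_iff_integrable.1 (memLp_mul_of_forall (hmem i)
      (memLp_prod_of_forall _ fun k ↦ memLp_polynomial_of_forall (hmem k) (q k)) 1 (by simp)))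
  have h2 := htransfer (fun p ↦ ∑ j, c j * ((derivative (q j)).eval (c j * p.1 + p.2 j) *
      ∏ k ∈ Finset.univ.erase j, (q k).eval (c k * p.1 + p.2 k))) (by fun_prop) (by
    simp only [hback]
    exact integrable_finsetSum _ fun j _ ↦ (hterm j).const_mul _)
  simp only [hback, ← hRe, ← hRd, integral_id_mul_polynomial_gaussianReal] at h1 h2
  rw [integral_finsetSum _ fun j _ ↦ (hterm j).const_mul _] at h2
  simp only [integral_const_mul] at h2
  rw [h1, h2]

/-- The probabilists' Hermite polynomials, with real coefficients. -/
noncomputable def realHermite (n : ℕ) : ℝ[X] := (hermite n).map (Int.castRingHom ℝ)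

lemma realHermite_zero : realHermite 0 = 1 := by simp [realHermite]

lemma realHermite_succ (n : ℕ) :
    realHermite (n + 1) = X * realHermite n - derivative (realHermite n) := by
  simp [realHermite, hermite_succ, derivative_map]

lemma derivative_realHermite (n : ℕ) :
    derivative (realHermite n) = (n : ℝ[X]) * realHermite (n - 1) := by
  induction n with
  | zero => simp [realHermite_zero]
  | succ n ih =>
    have h2 : (n : ℝ[X]) * derivative (realHermite (n - 1)) =
        (n : ℝ[X]) * (X * realHermite (n - 1)) - (n : ℝ[X]) * realHermite n := by
      rcases n with _ | n
      · simp
      · rw [Nat.add_sub_cancel, realHermite_succ n]; ring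
    rw [realHermite_succ, derivative_sub, derivative_mul, derivative_X, ih, derivative_mul,
      derivative_natCast, h2]
    push_cast
    ring

lemma realHermite_succ' (n : ℕ) :
    realHermite (n + 1) = X * realHermite n - (n : ℝ[X]) * realHermite (n - 1) := by
  rw [realHermite_succ, derivative_realHermite]

/-- The expectation of a product of Hermite polynomials of a family of random variables. -/
noncomputable def hermiteMoment (P : Measure Ω) (Y : ι → Ω → ℝ) (n : ι → ℕ) : ℝ :=
  ∫ ω, ∏ j, (realHermite (n j)).eval (Y j ω) ∂P

/-- The recursion behind the diagram formula: one of the legs at the vertex `i` is joined to a leg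
at another vertex. -/
lemma hermiteMoment_update_succ (hY : IsGaussianProcess Y P) (h0 : ∀ i, ∫ ω, Y i ω ∂P = 0)
    (i : ι) (hi : ∫ ω, Y i ω * Y i ω ∂P = 1) (n : ι → ℕ) :
    hermiteMoment P Y (Function.update n i (n i + 1)) = ∑ j ∈ Finset.univ.erase i,
      (∫ ω, Y i ω * Y j ω ∂P) * n j * hermiteMoment P Y (Function.update n j (n j - 1)) := by
  have hmem : ∀ j, ∀ p : ℝ≥0∞, p ≠ ∞ → MemLp (Y j) p P :=
    fun j p hp ↦ (hY.hasGaussianLaw_eval j).memLp hp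
  have hupd : ∀ (j : ι) (m : ℕ) (ω : Ω),
      ∏ k, (realHermite (Function.update n j m k)).eval (Y k ω)
      = (realHermite m).eval (Y j ω) * ∏ k ∈ Finset.univ.erase j, (realHermite (n k)).eval (Y k ω) := by
    intro j m ω
    rw [← Finset.mul_prod_erase _ _ (Finset.mem_univ j), Function.update_self]
    congr 1
    refine Finset.prod_congr rfl fun k hk ↦ ?_
    rw [Function.update_of_ne (Finset.ne_of_mem_erase hk)]
  have hint : ∀ (m : ι → ℕ) , Integrable (fun ω ↦ ∏ k, (realHermite (m k)).eval (Y k ω)) P :=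
    fun m ↦ memLp_one_iff_integrable.1
      (memLp_prod_of_forall _ (fun k ↦ memLp_polynomial_of_forall (hmem k) _) 1 (by simp))
  have hint' : Integrable (fun ω ↦ Y i ω * ∏ k, (realHermite (n k)).eval (Y k ω)) P :=
    memLp_one_iff_integrable.1 (memLp_mul_of_forall (hmem i)
      (memLp_prod_of_forall _ (fun k ↦ memLp_polynomial_of_forall (hmem k) _)) 1 (by simp))
  have hstein := integral_mul_prod_polynomial hY h0 i hi fun j ↦ realHermite (n j)
  have hder : ∀ j, ∫ ω, (derivative (realHermite (n j))).eval (Y j ω) *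
      ∏ k ∈ Finset.univ.erase j, (realHermite (n k)).eval (Y k ω) ∂P
      = n j * hermiteMoment P Y (Function.update n j (n j - 1)) := by
    intro j
    simp only [hermiteMoment, hupd, derivative_realHermite, eval_mul, eval_natCast, mul_assoc]
    rw [integral_const_mul]
  simp only [hder] at hstein
  rw [← Finset.add_sum_erase _ _ (Finset.mem_univ i), hi, one_mul] at hstein
  have hexp : hermiteMoment P Y (Function.update n i (n i + 1)) =
      ∫ ω, Y i ω * ∏ k, (realHermite (n k)).eval (Y k ω) ∂P
        - n i * hermiteMoment P Y (Function.update n i (n i - 1)) := by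
    rw [hermiteMoment, hermiteMoment, ← integral_const_mul,
      ← integral_sub hint' ((hint _).const_mul _)]
    refine integral_congr_ae (Filter.Eventually.of_forall fun ω ↦ ?_)
    simp only [hupd, realHermite_succ', eval_sub, eval_mul, eval_X, eval_natCast]
    rw [← Finset.mul_prod_erase _ (fun k ↦ (realHermite (n k)).eval (Y k ω)) (Finset.mem_univ i)]
    ring
  rw [hexp, hstein]
  simp only [mul_assoc, add_sub_cancel_left]

end Wick

/-! ### The diagram formula for the fourth moment -/

section DiagramFormula

variable {Ω : Type*} [MeasurableSpace Ω] {P : Measure Ω} [IsProbabilityMeasure P]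

/-- The solution of the recursion of `hermiteMoment_update_succ` at `(4, 4, 4, 4)`: a graph on four
vertices all of degree four is given by the multiplicities of the three perfect matchings. -/
lemma eval_hermite_recursion (M : ℕ → ℕ → ℕ → ℕ → ℝ) (r12 r13 r14 r23 r24 r34 : ℝ)
    (h1 : ∀ a b c d, M (a + 1) b c d = r12 * b * M a (b - 1) c d + r13 * c * M a b (c - 1) d
      + r14 * d * M a b c (d - 1))
    (h2 : ∀ b c d, M 0 (b + 1) c d = r23 * c * M 0 b (c - 1) d + r24 * d * M 0 b c (d - 1))
    (h3 : ∀ c d, M 0 0 (c + 1) d = r34 * d * M 0 0 c (d - 1))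
    (h4 : ∀ d, M 0 0 0 (d + 1) = 0) (h0 : M 0 0 0 0 = 1) :
    M 4 4 4 4 = 576 * (((r12 * r34) ^ 4 + (r13 * r24) ^ 4 + (r14 * r23) ^ 4)
      + 16 * ((r12 * r34) ^ 3 * (r13 * r24) + (r12 * r34) ^ 3 * (r14 * r23)
        + (r13 * r24) ^ 3 * (r12 * r34) + (r13 * r24) ^ 3 * (r14 * r23)
        + (r14 * r23) ^ 3 * (r12 * r34) + (r14 * r23) ^ 3 * (r13 * r24))
      + 36 * ((r12 * r34) ^ 2 * (r13 * r24) ^ 2 + (r12 * r34) ^ 2 * (r14 * r23) ^ 2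
        + (r13 * r24) ^ 2 * (r14 * r23) ^ 2)
      + 144 * ((r12 * r34) ^ 2 * (r13 * r24) * (r14 * r23)
        + (r12 * r34) * (r13 * r24) ^ 2 * (r14 * r23)
        + (r12 * r34) * (r13 * r24) * (r14 * r23) ^ 2)) := by
  -- closed forms in two variables, then the recursion in the second variable unfolded
  have k4 : ∀ d, M 0 0 0 d = if d = 0 then 1 else 0 := by
    intro d; rcases d with _ | d <;> simp [h0, h4]
  have k3 : ∀ c d, M 0 0 c d = if c = d then c.factorial * r34 ^ c else 0 := by
    intro c
    induction c with
    | zero => intro d; rw [k4]; simp [eq_comm]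
    | succ c ih =>
      intro d
      rw [h3, ih]
      rcases d with _ | d
      · simp
      · simp only [Nat.add_sub_cancel, Nat.add_right_cancel_iff]
        split_ifs with h
        · subst h; rw [Nat.factorial_succ]; push_cast; ring
        · simp
  have k1 : ∀ c d, M 0 1 c d = r23 * c * M 0 0 (c - 1) d + r24 * d * M 0 0 c (d - 1) := h2 0
  have k2 : ∀ c d, M 0 2 c d = r23 * c * M 0 1 (c - 1) d + r24 * d * M 0 1 c (d - 1) := h2 1
  have k5 : ∀ c d, M 0 3 c d = r23 * c * M 0 2 (c - 1) d + r24 * d * M 0 2 c (d - 1) := h2 2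
  have k6 : ∀ c d, M 0 4 c d = r23 * c * M 0 3 (c - 1) d + r24 * d * M 0 3 c (d - 1) := h2 3
  rw [h1 3]
  simp only [h1 2, h1 1, h1 0, k6, k5, k2, k1, k3, Nat.reduceSub, Nat.cast_ofNat]
  simp [Nat.factorial]
  ring

/-- The diagram formula for four Hermite polynomials of degree four. -/
lemma hermiteMoment_four {Y : Fin 4 → Ω → ℝ} (hY : IsGaussianProcess Y P)
    (h0 : ∀ i, ∫ ω, Y i ω ∂P = 0) (r : Fin 4 → Fin 4 → ℝ)
    (hr : ∀ i j, ∫ ω, Y i ω * Y j ω ∂P = r i j)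
    (h1 : ∀ i, r i i = 1) :
    hermiteMoment P Y ![4, 4, 4, 4] = 576 *
      (((r 0 1 * r 2 3) ^ 4 + (r 0 2 * r 1 3) ^ 4 + (r 0 3 * r 1 2) ^ 4)
      + 16 * ((r 0 1 * r 2 3) ^ 3 * (r 0 2 * r 1 3) + (r 0 1 * r 2 3) ^ 3 * (r 0 3 * r 1 2)
        + (r 0 2 * r 1 3) ^ 3 * (r 0 1 * r 2 3) + (r 0 2 * r 1 3) ^ 3 * (r 0 3 * r 1 2)
        + (r 0 3 * r 1 2) ^ 3 * (r 0 1 * r 2 3) + (r 0 3 * r 1 2) ^ 3 * (r 0 2 * r 1 3))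
      + 36 * ((r 0 1 * r 2 3) ^ 2 * (r 0 2 * r 1 3) ^ 2 + (r 0 1 * r 2 3) ^ 2 * (r 0 3 * r 1 2) ^ 2
        + (r 0 2 * r 1 3) ^ 2 * (r 0 3 * r 1 2) ^ 2)
      + 144 * ((r 0 1 * r 2 3) ^ 2 * (r 0 2 * r 1 3) * (r 0 3 * r 1 2)
        + (r 0 1 * r 2 3) * (r 0 2 * r 1 3) ^ 2 * (r 0 3 * r 1 2)
        + (r 0 1 * r 2 3) * (r 0 2 * r 1 3) * (r 0 3 * r 1 2) ^ 2)) := by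
  have hrec := fun i n ↦ hermiteMoment_update_succ hY h0 i ((hr i i).trans (h1 i)) n
  simp only [hr] at hrec
  have e0 : (Finset.univ.erase 0 : Finset (Fin 4)) = {1, 2, 3} := by decide
  have e1 : (Finset.univ.erase 1 : Finset (Fin 4)) = {0, 2, 3} := by decide
  have e2 : (Finset.univ.erase 2 : Finset (Fin 4)) = {0, 1, 3} := by decide
  have e3 : (Finset.univ.erase 3 : Finset (Fin 4)) = {0, 1, 2} := by decide
  have u0 : ∀ a b c d m : ℕ, Function.update ![a, b, c, d] 0 m = ![m, b, c, d] := by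
    intros; ext i; fin_cases i <;> rfl
  have u1 : ∀ a b c d m : ℕ, Function.update ![a, b, c, d] 1 m = ![a, m, c, d] := by
    intros; ext i; fin_cases i <;> rfl
  have u2 : ∀ a b c d m : ℕ, Function.update ![a, b, c, d] 2 m = ![a, b, m, d] := by
    intros; ext i; fin_cases i <;> rfl
  have u3 : ∀ a b c d m : ℕ, Function.update ![a, b, c, d] 3 m = ![a, b, c, m] := by
    intros; ext i; fin_cases i <;> rfl
  refine eval_hermite_recursion (fun a b c d ↦ hermiteMoment P Y ![a, b, c, d])
    (r 0 1) (r 0 2) (r 0 3) (r 1 2) (r 1 3) (r 2 3) ?_ ?_ ?_ ?_ ?_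
  · intro a b c d
    have := hrec 0 ![a, b, c, d]
    rw [e0, Finset.sum_insert (by decide), Finset.sum_insert (by decide),
      Finset.sum_singleton] at this
    simp only [u0, u1, u2, u3, Matrix.cons_val] at this
    rw [this]; ring
  · intro b c d
    have := hrec 1 ![0, b, c, d]
    rw [e1, Finset.sum_insert (by decide), Finset.sum_insert (by decide),
      Finset.sum_singleton] at this
    simp only [u0, u1, u2, u3, Matrix.cons_val] at this
    rw [this]; push_cast; ring
  · intro c d
    have := hrec 2 ![0, 0, c, d]
    rw [e2, Finset.sum_insert (by decide), Finset.sum_insert (by decide),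
      Finset.sum_singleton] at this
    simp only [u0, u1, u2, u3, Matrix.cons_val] at this
    rw [this]; push_cast; ring
  · intro d
    have := hrec 3 ![0, 0, 0, d]
    rw [e3, Finset.sum_insert (by decide), Finset.sum_insert (by decide),
      Finset.sum_singleton] at this
    simp only [u0, u1, u2, u3, Matrix.cons_val] at this
    rw [this]; push_cast; ring
  · simp [hermiteMoment, realHermite_zero, Fin.prod_univ_four]

/-- Orthogonality of the Hermite polynomials of two jointly Gaussian variables. -/
lemma hermiteMoment_two {Y : Fin 2 → Ω → ℝ} (hY : IsGaussianProcess Y P)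
    (h0 : ∀ i, ∫ ω, Y i ω ∂P = 0) (r : Fin 2 → Fin 2 → ℝ)
    (hr : ∀ i j, ∫ ω, Y i ω * Y j ω ∂P = r i j)
    (h1 : ∀ i, r i i = 1) (a b : ℕ) :
    hermiteMoment P Y ![a, b] = if a = b then a.factorial * r 0 1 ^ a else 0 := by
  have hrec := fun i n ↦ hermiteMoment_update_succ hY h0 i ((hr i i).trans (h1 i)) n
  simp only [hr] at hrec
  have e0 : (Finset.univ.erase 0 : Finset (Fin 2)) = {1} := by decide
  have e1 : (Finset.univ.erase 1 : Finset (Fin 2)) = {0} := by decide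
  have u0 : ∀ a b m : ℕ, Function.update ![a, b] 0 m = ![m, b] := by
    intros; ext i; fin_cases i <;> rfl
  have u1 : ∀ a b m : ℕ, Function.update ![a, b] 1 m = ![a, m] := by
    intros; ext i; fin_cases i <;> rfl
  induction a generalizing b with
  | zero =>
    rcases b with _ | b
    · simp [hermiteMoment, realHermite_zero]
    · have := hrec 1 ![0, b]
      rw [e1, Finset.sum_singleton] at this
      simp only [u0, u1, Matrix.cons_val] at this
      rw [this]; simp
  | succ a ih =>
    have := hrec 0 ![a, b]
    rw [e0, Finset.sum_singleton] at this
    simp only [u0, u1, Matrix.cons_val] at this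
    rw [this, ih]
    rcases b with _ | b
    · simp
    · simp only [Nat.add_sub_cancel, Nat.add_right_cancel_iff]
      split_ifs with h
      · subst h; rw [Nat.factorial_succ]; push_cast; ring
      · simp

end DiagramFormula

section Cumulant

/-! ### Moments and fourth cumulant of the Hermite integral -/

variable {l : ℕ} {Ω : Type*} [MeasurableSpace Ω] {P : Measure Ω}
  {f : S2 → Ω → ℝ}

/-- The random field `H₄(f(x))`. -/
noncomputable def hermiteField (f : S2 → Ω → ℝ) (x : S2) (ω : Ω) : ℝ :=
  (realHermite 4).eval (f x ω)

lemma hermiteIntegral_four {Ω : Type*} (f : S2 → Ω → ℝ) (ω : Ω) :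
    hermiteIntegral 4 f ω = ∫ x, hermiteField f x ω ∂surfaceMeasure := by
  simp only [hermiteIntegral, hermiteField, realHermite, aeval_def, eval_map]
  rfl

namespace IsGaussianEigenfunction

lemma measurable_hermiteField (hf : IsGaussianEigenfunction l P f) :
    Measurable (Function.uncurry (hermiteField f)) :=
  (realHermite 4).continuous.measurable.comp hf.measurable_uncurry

lemma isGaussianProcess_comp (hf : IsGaussianEigenfunction l P f) {ι : Type*} (x : ι → S2) :
    IsGaussianProcess (fun i ↦ f (x i)) P := hf.isGaussianProcess.comp_right x

variable [IsProbabilityMeasure P]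

lemma memLp_hermiteField (hf : IsGaussianEigenfunction l P f) (x : S2) :
    ∀ p : ℝ≥0∞, p ≠ ∞ → MemLp (hermiteField f x) p P :=
  memLp_polynomial_of_forall (fun _ hp ↦ hf.memLp x hp) _

lemma integral_hermiteField_pow_four (hf : IsGaussianEigenfunction l P f) (x : S2) :
    ∫ ω, hermiteField f x ω ^ 4 ∂P = 576 * (3 + 16 * 6 + 36 * 3 + 144 * 3) := by
  have := hermiteMoment_four (hf.isGaussianProcess_comp fun _ : Fin 4 ↦ x)
    (fun _ ↦ hf.mean_eq_zero x) (fun _ _ ↦ 1)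
    (fun _ _ ↦ by rw [hf.integral_mul, kernel_self]) (fun _ ↦ rfl)
  rw [hermiteMoment] at this
  simp only [Fin.prod_univ_four, Matrix.cons_val] at this
  simp only [hermiteField, pow_succ, pow_zero, one_mul]
  rw [this]; norm_num

lemma integrable_hermiteField_pow_four (hf : IsGaussianEigenfunction l P f) (x : S2) :
    Integrable (fun ω ↦ hermiteField f x ω ^ 4) P := by
  have := (hf.memLp_hermiteField x 4 (by simp)).integrable_norm_pow (p := 4) (by simp)
  refine this.congr (Filter.Eventually.of_forall fun ω ↦ ?_)
  simp only [Real.norm_eq_abs]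
  exact Even.pow_abs (by decide) _

lemma integrable_hermiteField (hf : IsGaussianEigenfunction l P f) :
    Integrable (Function.uncurry (hermiteField f)) (surfaceMeasure.prod P) := by
  refine integrable_uncurry_of_integral_abs_le hf.measurable_hermiteField
    (fun x ↦ memLp_one_iff_integrable.1 (hf.memLp_hermiteField x 1 (by simp)))
    (1 + 576 * (3 + 16 * 6 + 36 * 3 + 144 * 3)) fun x ↦ ?_
  rw [← hf.integral_hermiteField_pow_four x]
  have h1 : Integrable (fun _ : Ω ↦ (1 : ℝ)) P := integrable_const _
  have e : (1 : ℝ) = ∫ _ : Ω, (1 : ℝ) ∂P := by simp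
  rw [e, ← integral_add h1 (hf.integrable_hermiteField_pow_four x)]
  refine integral_mono (memLp_one_iff_integrable.1 (hf.memLp_hermiteField x 1 (by simp))).abs
    (h1.add (hf.integrable_hermiteField_pow_four x)) fun ω ↦ ?_
  simp only
  have := sq_nonneg (hermiteField f x ω ^ 2 - 1 / 2)
  exact abs_le.2 ⟨by nlinarith [sq_nonneg (hermiteField f x ω + 1 / 2)],
    by nlinarith [sq_nonneg (hermiteField f x ω - 1 / 2)]⟩

lemma integral_hermiteIntegral (hf : IsGaussianEigenfunction l P f) :
    ∫ ω, hermiteIntegral 4 f ω ∂P = 0 := by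
  simp only [hermiteIntegral_four]
  rw [← integral_integral_swap hf.integrable_hermiteField]
  have : ∀ x, ∫ ω, hermiteField f x ω ∂P = 0 := by
    intro x
    have := hermiteMoment_two (hf.isGaussianProcess_comp fun _ : Fin 2 ↦ x)
      (fun _ ↦ hf.mean_eq_zero x) (fun _ _ ↦ 1)
      (fun _ _ ↦ by rw [hf.integral_mul, kernel_self]) (fun _ ↦ rfl) 4 0
    rw [hermiteMoment] at this
    simpa [Fin.prod_univ_two, realHermite_zero, hermiteField] using this
  simp [this]

lemma integral_hermiteIntegral_sq (hf : IsGaussianEigenfunction l P f) :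
    ∫ ω, hermiteIntegral 4 f ω ^ 2 ∂P = 24 * ∫ u, kernel l u.1 u.2 ^ 4 ∂pairMeasure := by
  have hL : ∀ u : S2 × S2, Integrable (fun ω ↦ hermiteField f u.1 ω * hermiteField f u.2 ω) P :=
    fun u ↦ memLp_one_iff_integrable.1
      (memLp_mul_of_forall (hf.memLp_hermiteField u.1) (hf.memLp_hermiteField u.2) 1 (by simp))
  have hI : Integrable (Function.uncurry fun (u : S2 × S2) ω ↦
      hermiteField f u.1 ω * hermiteField f u.2 ω) (pairMeasure.prod P) := by
    refine integrable_uncurry_of_integral_abs_le ?_ hL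
      (1 + 576 * (3 + 16 * 6 + 36 * 3 + 144 * 3)) fun u ↦ ?_
    · exact (hf.measurable_hermiteField.comp (by fun_prop :
        Measurable fun p : (S2 × S2) × Ω ↦ (p.1.1, p.2))).mul
        (hf.measurable_hermiteField.comp (by fun_prop :
        Measurable fun p : (S2 × S2) × Ω ↦ (p.1.2, p.2)))
    · have h1 : Integrable (fun _ : Ω ↦ (1 : ℝ)) P := integrable_const _
      have hi : Integrable (fun ω ↦ 1 / 2 * hermiteField f u.1 ω ^ 4
          + 1 / 2 * hermiteField f u.2 ω ^ 4) P :=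
        ((hf.integrable_hermiteField_pow_four u.1).const_mul (1 / 2)).add
          ((hf.integrable_hermiteField_pow_four u.2).const_mul (1 / 2))
      have h2 : ∫ ω, (1 + (1 / 2 * hermiteField f u.1 ω ^ 4 + 1 / 2 * hermiteField f u.2 ω ^ 4)) ∂P
          = 1 + 576 * (3 + 16 * 6 + 36 * 3 + 144 * 3) := by
        rw [integral_add h1 hi, integral_add ((hf.integrable_hermiteField_pow_four u.1).const_mul _)
          ((hf.integrable_hermiteField_pow_four u.2).const_mul _), integral_const_mul,
          integral_const_mul, hf.integral_hermiteField_pow_four, hf.integral_hermiteField_pow_four]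
        simp
        norm_num
      rw [← h2]
      refine integral_mono (hL u).abs (h1.add hi) fun ω ↦ ?_
      simp only
      set a := hermiteField f u.1 ω
      set b := hermiteField f u.2 ω
      have := sq_nonneg (a ^ 2 - 1 / 2)
      have := sq_nonneg (b ^ 2 - 1 / 2)
      exact abs_le.2 ⟨by nlinarith [sq_nonneg (a + b)], by nlinarith [sq_nonneg (a - b)]⟩
  have hsq : ∀ ω, hermiteIntegral 4 f ω ^ 2
      = ∫ u : S2 × S2, hermiteField f u.1 ω * hermiteField f u.2 ω ∂pairMeasure := by
    intro ω
    rw [hermiteIntegral_four, sq, ← integral_prod_mul]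
  simp only [hsq]
  rw [← integral_integral_swap hI, ← integral_const_mul]
  refine integral_congr_ae (Filter.Eventually.of_forall fun u ↦ ?_)
  have := hermiteMoment_two (hf.isGaussianProcess_comp ![u.1, u.2])
      (fun _ ↦ hf.mean_eq_zero _) (fun i j ↦ kernel l (![u.1, u.2] i) (![u.1, u.2] j))
      (fun _ _ ↦ hf.integral_mul _ _) (fun _ ↦ kernel_self _ _) 4 4
  rw [hermiteMoment] at this
  simp only [Fin.prod_univ_two, Matrix.cons_val, if_true] at this
  refine this.trans ?_
  simp [Nat.factorial]

lemma integral_hermiteField_prod_four (hf : IsGaussianEigenfunction l P f) (z : Quad) :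
    ∫ ω, (hermiteField f z.1.1 ω * hermiteField f z.1.2 ω) *
      (hermiteField f z.2.1 ω * hermiteField f z.2.2 ω) ∂P =
    576 * ((matchingA l z ^ 4 * matchingB l z ^ 0 * matchingC l z ^ 0
        + matchingA l z ^ 0 * matchingB l z ^ 4 * matchingC l z ^ 0
        + matchingA l z ^ 0 * matchingB l z ^ 0 * matchingC l z ^ 4)
      + 16 * (matchingA l z ^ 3 * matchingB l z ^ 1 * matchingC l z ^ 0
        + matchingA l z ^ 3 * matchingB l z ^ 0 * matchingC l z ^ 1
        + matchingA l z ^ 1 * matchingB l z ^ 3 * matchingC l z ^ 0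
        + matchingA l z ^ 0 * matchingB l z ^ 3 * matchingC l z ^ 1
        + matchingA l z ^ 1 * matchingB l z ^ 0 * matchingC l z ^ 3
        + matchingA l z ^ 0 * matchingB l z ^ 1 * matchingC l z ^ 3)
      + 36 * (matchingA l z ^ 2 * matchingB l z ^ 2 * matchingC l z ^ 0
        + matchingA l z ^ 2 * matchingB l z ^ 0 * matchingC l z ^ 2
        + matchingA l z ^ 0 * matchingB l z ^ 2 * matchingC l z ^ 2)
      + 144 * (matchingA l z ^ 2 * matchingB l z ^ 1 * matchingC l z ^ 1
        + matchingA l z ^ 1 * matchingB l z ^ 2 * matchingC l z ^ 1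
        + matchingA l z ^ 1 * matchingB l z ^ 1 * matchingC l z ^ 2)) := by
  set x : Fin 4 → S2 := ![z.1.1, z.1.2, z.2.1, z.2.2] with hx
  have := hermiteMoment_four (hf.isGaussianProcess_comp x)
      (fun _ ↦ hf.mean_eq_zero _) (fun i j ↦ kernel l (x i) (x j))
      (fun _ _ ↦ hf.integral_mul _ _) (fun _ ↦ kernel_self _ _)
  rw [hermiteMoment] at this
  simp only [Fin.prod_univ_four, hx, Matrix.cons_val] at this
  simp only [hermiteField, ← mul_assoc] at this ⊢
  rw [this]
  simp only [matchingA, matchingB, matchingC]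
  ring

lemma integral_hermiteIntegral_pow_four (hf : IsGaussianEigenfunction l P f) :
    ∫ ω, hermiteIntegral 4 f ω ^ 4 ∂P = 576 * (3 * diagramIntegral l 4 0 0
      + 96 * diagramIntegral l 3 1 0 + 108 * diagramIntegral l 2 2 0
      + 432 * diagramIntegral l 2 1 1) := by
  set F : Quad → Ω → ℝ := fun z ω ↦ (hermiteField f z.1.1 ω * hermiteField f z.1.2 ω) *
    (hermiteField f z.2.1 ω * hermiteField f z.2.2 ω) with hF
  have hL : ∀ z : Quad, Integrable (F z) P :=
    fun z ↦ memLp_one_iff_integrable.1 (memLp_mul_of_forall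
      (memLp_mul_of_forall (hf.memLp_hermiteField _) (hf.memLp_hermiteField _))
      (memLp_mul_of_forall (hf.memLp_hermiteField _) (hf.memLp_hermiteField _)) 1 (by simp))
  have hI : Integrable (Function.uncurry F) (quadMeasure.prod P) := by
    have hm : ∀ g : Quad → S2, Measurable g →
        Measurable fun p : Quad × Ω ↦ hermiteField f (g p.1) p.2 := fun g hg ↦
      hf.measurable_hermiteField.comp ((hg.comp measurable_fst).prodMk measurable_snd)
    refine integrable_uncurry_of_integral_abs_le ?_ hL
      (576 * (3 + 16 * 6 + 36 * 3 + 144 * 3)) fun z ↦ ?_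
    · exact ((hm (fun z ↦ z.1.1) (by fun_prop)).mul (hm (fun z ↦ z.1.2) (by fun_prop))).mul
        ((hm (fun z ↦ z.2.1) (by fun_prop)).mul (hm (fun z ↦ z.2.2) (by fun_prop)))
    · have hi := fun x ↦ (hf.integrable_hermiteField_pow_four x).const_mul (1 / 4)
      have hi2 : ∀ x y, Integrable (fun ω ↦ 1 / 4 * hermiteField f x ω ^ 4
          + 1 / 4 * hermiteField f y ω ^ 4) P := fun x y ↦ (hi x).add (hi y)
      have h2 : ∫ ω, ((1 / 4 * hermiteField f z.1.1 ω ^ 4 + 1 / 4 * hermiteField f z.1.2 ω ^ 4)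
          + (1 / 4 * hermiteField f z.2.1 ω ^ 4 + 1 / 4 * hermiteField f z.2.2 ω ^ 4)) ∂P
          = 576 * (3 + 16 * 6 + 36 * 3 + 144 * 3) := by
        rw [integral_add (hi2 _ _) (hi2 _ _), integral_add (hi _) (hi _),
          integral_add (hi _) (hi _)]
        simp only [integral_const_mul, hf.integral_hermiteField_pow_four]
        norm_num
      rw [← h2]
      refine integral_mono (hL z).abs ((hi2 _ _).add (hi2 _ _)) fun ω ↦ ?_
      simp only [hF]
      set a := hermiteField f z.1.1 ω
      set b := hermiteField f z.1.2 ω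
      set c := hermiteField f z.2.1 ω
      set d := hermiteField f z.2.2 ω
      have h3 := sq_nonneg (a ^ 2 - b ^ 2)
      have h4 := sq_nonneg (c ^ 2 - d ^ 2)
      have h5 := sq_nonneg (a * b - c * d)
      have h6 := sq_nonneg (a * b + c * d)
      exact abs_le.2 ⟨by linarith, by linarith⟩
  have hpow : ∀ ω, hermiteIntegral 4 f ω ^ 4 = ∫ z, F z ω ∂quadMeasure := by
    intro ω
    rw [hermiteIntegral_four, hF, integral_prod_mul
      (fun u : S2 × S2 ↦ hermiteField f u.1 ω * hermiteField f u.2 ω)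
      (fun u : S2 × S2 ↦ hermiteField f u.1 ω * hermiteField f u.2 ω),
      integral_prod_mul (fun x ↦ hermiteField f x ω) (fun x ↦ hermiteField f x ω)]
    ring
  simp only [hpow]
  rw [← integral_integral_swap hI]
  simp only [hF, hf.integral_hermiteField_prod_four]
  have hadd : ∀ F G : Quad → ℝ, Continuous F → Continuous G →
      ∫ z, (F z + G z) ∂quadMeasure = ∫ z, F z ∂quadMeasure + ∫ z, G z ∂quadMeasure :=
    fun F G hF hG ↦ integral_add (integrable_of_continuous hF) (integrable_of_continuous hG)
  have hd : ∀ a b c, ∫ z, matchingA l z ^ a * matchingB l z ^ b * matchingC l z ^ c ∂quadMeasure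
    = diagramIntegral l a b c := fun _ _ _ ↦ rfl
  simp (disch := fun_prop) only [hadd, integral_const_mul, hd]
  have s1 := diagramIntegral_swap_left l 4 0 0
  have s2 := diagramIntegral_swap_right l 0 4 0
  have s3 := diagramIntegral_swap_right l 3 1 0
  have s4 := diagramIntegral_swap_left l 3 1 0
  have s5 := diagramIntegral_swap_left l 3 0 1
  have s6 := diagramIntegral_swap_right l 1 3 0
  have s7 := diagramIntegral_swap_right l 0 3 1
  have s8 := diagramIntegral_swap_right l 2 2 0
  have s9 := diagramIntegral_swap_left l 2 0 2
  have s10 := diagramIntegral_swap_left l 2 1 1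
  have s11 := diagramIntegral_swap_right l 1 2 1
  linarith

/-- The contribution of the disconnected diagrams is cancelled by `3 Var²`. -/
lemma fourthCumulant_eq (hf : IsGaussianEigenfunction l P f) :
    fourthCumulant (hermiteIntegral 4 f) P = 6912 * (8 * diagramIntegral l 3 1 0
      + 9 * diagramIntegral l 2 2 0 + 36 * diagramIntegral l 2 1 1) := by
  have hm : StronglyMeasurable (hermiteIntegral 4 f) := by
    have := (hf.measurable_hermiteField.stronglyMeasurable).integral_prod_left (μ := surfaceMeasure)
    have e : hermiteIntegral 4 f = fun ω ↦ ∫ x, hermiteField f x ω ∂surfaceMeasure :=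
      funext fun ω ↦ hermiteIntegral_four f ω
    rw [e]
    exact this
  have h4 : centralMoment (hermiteIntegral 4 f) 4 P = ∫ ω, hermiteIntegral 4 f ω ^ 4 ∂P := by
    simp [centralMoment, hf.integral_hermiteIntegral]
  rw [fourthCumulant, h4, variance_of_integral_eq_zero hm.measurable.aemeasurable
    hf.integral_hermiteIntegral, hf.integral_hermiteIntegral_sq,
    hf.integral_hermiteIntegral_pow_four, diagramIntegral_four]
  ring

end IsGaussianEigenfunction

end Cumulant

end SphericalField

theorem lemma3p3 :
    ∃ c₁ c₂ : ℝ, 0 < c₁ ∧ 0 < c₂ ∧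
      ∀ (l : ℕ), 1 ≤ l →
      ∀ (Ω : Type*) [MeasurableSpace Ω] (P : Measure Ω) [IsProbabilityMeasure P]
        (f : SphericalField.S2 → Ω → ℝ), SphericalField.IsGaussianEigenfunction l P f →
        c₁ * ((l : ℝ) ^ 4)⁻¹ ≤
            SphericalField.fourthCumulant (SphericalField.hermiteIntegral 4 f) P ∧
          SphericalField.fourthCumulant (SphericalField.hermiteIntegral 4 f) P ≤
            c₂ * ((l : ℝ) ^ 4)⁻¹ := by
  refine ⟨62208 * (4 * Real.pi / 3) ^ 4, 6912 * 53 * (2048 * Real.pi ^ 4), by positivity,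
    by positivity, fun l hl Ω _ P _ f hf ↦ ?_⟩
  have hl' : (1 : ℝ) ≤ l := by exact_mod_cast hl
  have hl0 : (0 : ℝ) < l := by linarith
  rw [hf.fourthCumulant_eq]
  constructor
  -- `8 J(3,1,0) + 36 J(2,1,1) = 36/5 (J(3,1,0) + 5 J(2,1,1)) + 4/5 J(3,1,0)` is nonnegative
  · have h1 := SphericalField.le_diagramIntegral_two_two l
    have h2 := hf.diagramIntegral_three_one_nonneg
    have h3 := hf.diagramIntegral_combination_nonneg
    have h4 : (4 * Real.pi / 3) ^ 4 * ((l : ℝ) ^ 4)⁻¹ ≤ (4 * Real.pi / (2 * (l : ℝ) + 1)) ^ 4 := by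
      rw [← inv_pow, ← mul_pow, ← div_eq_mul_inv, div_div]
      gcongr
      linarith
    linarith
  · have h1 := SphericalField.integral_abs_matching_le l hl
    have h2 := SphericalField.diagramIntegral_three_one_le l
    have h3 := SphericalField.diagramIntegral_two_two_le l
    have h4 := SphericalField.diagramIntegral_two_one_one_le l
    have h5 : (2 / (2 * (l : ℝ) + 1)) ^ 4 ≤ ((l : ℝ) ^ 4)⁻¹ := by
      rw [← inv_pow]
      gcongr
      rw [div_le_iff₀ (by positivity)]
      field_simp
      linarith
    have h6 := mul_le_mul_of_nonneg_left h5 (by positivity : 0 ≤ 2048 * Real.pi ^ 4)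
    linarith
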